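/- **Setting.** Let $\mathcal F$ be the complex vector space with basis the normalised states $|n_1,n_2\rangle$ ($n_1,n_2\in\mathbb N_0$), with annihilation and creation operators $a_\alpha|n\rangle=\sqrt{n_\alpha}\,|n-e_\alpha\rangle$, $a^{\dagger\alpha}|n\rangle=\sqrt{n_\alpha+1}\,|n+e_\alpha\rangle$ ($\alpha=1,2$), and let $\mathcal A=\mathrm{End}(\mathcal F)$. On $\mathcal A$ put $\hat a_\alpha\Psi=a_\alpha\Psi$, $\hat a^{\dagger\alpha}\Psi=a^{\dagger\alpha}\Psi$, $\hat b_\alpha\Psi=\Psi a_\alpha$, $\hat b^{\dagger}_\alpha\Psi=\Psi a^{\dagger\alpha}$, $\hat A=(\hat a_1,\hat a_2,\hat b_1,\hat b_2)^T$, $\hat A^\dagger=(\hat a^{\dagger1},\hat a^{\dagger2},\hat b^\dagger_1,\hat b^\dagger_2)$. Let $\Gamma=\mathrm{diag}(1,1,-1,-1)$ and $su(2,2)=\{X\in M_4(\mathbb C): X^\dagger\Gamma+\Gamma X=0,\ \mathrm{tr}X=0\}$. The fundamental oscillator representation is $\hat X=\hat A^\dagger\Gamma X\hat A$, the dual one is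 $\tilde X=\hat A^\dagger\Gamma(-X^T)\hat A$. With $\eta=\mathrm{diag}(1,-1,-1,-1)$, the Dirac matrices $\gamma^\mu$ in the Dirac basis, $\gamma_\mu=\eta_{\mu\mu}\gamma^\mu$ and $\gamma_5=-i\gamma^0\gamma^1\gamma^2\gamma^3$, put $S_{\mu\nu}=-\frac14[\gamma_\mu,\gamma_\nu]$, $S_{\mu4}=\frac i2\gamma_5\gamma_\mu$, $S_{\mu5}=-\frac i2\gamma_\mu$, $P_\mu=S_{\mu5}+S_{\mu4}$; in either representation $P^2=P_\mu P^\mu$, $W_\mu=\frac12\varepsilon_{\mu\nu\rho\sigma}S^{\nu\rho}P^\sigma$ ($\varepsilon_{0123}=1$), $W^2=W_\mu W^\mu$. A subspace has helicity $h$ if on it $W_\mu=hP_\mu$ holds for the hermitian generators $iS_{\mu\nu},iP_\mu$, i.e. $-W_\mu=ih\,P_\mu$ for the generators above. For $\kappa\in\mathbb N_0$ let $\mathcal A_\kappa$ be the space of all $\Psi\in\mathcal A$ that are normal-ordered power series $\sum c_{n_1n_2m_1m_2}(a^{\dagger1})^{n_1}(a^{\dagger2})^{n_2}(a_1)^{m_1}(a_2)^{m_2}$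 in monomials of chiral parameter $(n_1+n_2)-(m_1+m_2)=\kappa$ (on each vector of $\mathcal F$ only finitely many terms are non-zero), and let $\mathcal A_\kappa^{\rm fin}\subset\mathcal A_\kappa$ be the linear span of these monomials. **Theorem.** Let $\kappa\in\mathbb N_0$. The map $X\mapsto\hat X$ is a representation of $su(2,2)$ on $\mathcal A$, and: 1. $\mathcal A_\kappa^{\rm fin}$ and $\mathcal A_\kappa$ are $su(2,2)$-invariant, and $su(2,2)$ acts irreducibly on $\mathcal A_\kappa^{\rm fin}$. 2. On $\mathcal A_\kappa$ one has $\hat P^2=0$, $\hat W^2=0$, and the helicity is $\kappa/2$. 3. The eigenvalues of $i\hat S_{05}$ on $\mathcal A_\kappa$ are exactly $1+\frac\kappa2+k$, $k\in\mathbb N_0$; the lowest one is $d=1+\kappa/2$. 4. Let $\mathcal V_\kappa$ be the span of the eigenvectors of $i\hat S_{05}$ in $\mathcal A_\kappa$. It consists of Hilbert–Schmidt operators and is $su(2,2)$-invariant; $su(2,2)$ acts on it irreducibly, and by skew-hermitian operators for $\langle\Psi,\Phi\rangle=\mathrm{Tr}(\Psi^\dagger\Phi)$; and the eigenspace of the lowest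 eigenvalue $d$ is the irreducible representation of the block-diagonal $su(2)\oplus su(2)$ with spins $(j_1,j_2)=(\kappa/2,0)$. So $\mathcal V_\kappa$ is the unitary irreducible lowest weight representation of Mack's massless (doubleton) class, $j_1j_2=0$, $d=j_1+j_2+1$, helicity $j_1-j_2=\kappa/2$. The same holds for the dual representation $X\mapsto\tilde X$, with the signs of the energy and of the helicity reversed: $-i\tilde S_{05}$ takes the place of $i\hat S_{05}$ (so the eigenvalues of $i\tilde S_{05}$ on $\mathcal A_\kappa$ are $-(1+\frac\kappa2+k)$), and the helicity is $-\kappa/2$. -/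

import Mathlib

noncomputable section

namespace FuzzyDoubleton

/- The commutator bracket on associative algebras. -/
attribute [local instance 100] LieRing.ofAssociativeRing

/-! ### The Fock space of two oscillators and the algebra of fuzzy functions -/

/-- Occupation numbers `(n₁, n₂)`. -/
abbrev Occ : Type := Fin 2 → ℕ

/-- The Fock space: the complex vector space with basis the normalised states `|n₁, n₂⟩`. -/
def Fock : Type := Occ →₀ ℂ

instance : AddCommGroup Fock := inferInstanceAs (AddCommGroup (Occ →₀ ℂ))

instance : Module ℂ Fock := inferInstanceAs (Module ℂ (Occ →₀ ℂ))

/-- The basis of the Fock space given by the normalised states. -/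
def ketBasis : Module.Basis Occ ℂ Fock := Module.Basis.ofRepr (LinearEquiv.refl ℂ (Occ →₀ ℂ))

/-- The normalised state `|n₁, n₂⟩`. -/
def ket (n : Occ) : Fock := ketBasis n

/-- The annihilation operator `a_α |n⟩ = √n_α |n - e_α⟩` (the vector is `0` when `n_α = 0`). -/
def ann (α : Fin 2) : Module.End ℂ Fock :=
  ketBasis.constr ℂ fun n : Occ => ((√(n α : ℝ) : ℝ) : ℂ) • ket (n - Pi.single α 1)

/-- The creation operator `a^{†α} |n⟩ = √(n_α + 1) |n + e_α⟩`. -/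
def cre (α : Fin 2) : Module.End ℂ Fock :=
  ketBasis.constr ℂ fun n : Occ => ((√((n α : ℝ) + 1) : ℝ) : ℂ) • ket (n + Pi.single α 1)

/-- The algebra of fuzzy functions `𝒜 = End(Fock)`. -/
abbrev Fuzzy : Type := Module.End ℂ Fock

/-- The normal-ordered fuzzy monomial `(a^{†1})^{n₁} (a^{†2})^{n₂} (a₁)^{m₁} (a₂)^{m₂}`. -/
def monomial (n m : Occ) : Fuzzy :=
  cre 0 ^ n 0 * cre 1 ^ n 1 * ann 0 ^ m 0 * ann 1 ^ m 1

/-- The chiral parameter `(n₁ + n₂) - (m₁ + m₂)` of a monomial. -/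
def chirality (n m : Occ) : ℤ := ((n 0 : ℤ) + n 1) - ((m 0 : ℤ) + m 1)

/-- The linear span (finite linear combinations) of the monomials of chiral parameter `κ`. -/
def monoSpan (κ : ℤ) : Submodule ℂ Fuzzy :=
  Submodule.span ℂ {Ψ | ∃ n m : Occ, chirality n m = κ ∧ Ψ = monomial n m}

/-- `Ψ = ∑ c n m • monomial n m` as a normal-ordered power series: on every vector of the Fock
space only finitely many terms are non-zero, and they sum to the value of `Ψ`. -/
def HasExpansion (c : Occ × Occ → ℂ) (Ψ : Fuzzy) : Prop :=
  ∀ v : Fock, (Function.support fun p : Occ × Occ => c p • monomial p.1 p.2 v).Finite ∧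
    Ψ v = ∑ᶠ p : Occ × Occ, c p • monomial p.1 p.2 v

/-- The fuzzy functions of chiral parameter `κ`: all normal-ordered power series in the monomials
of chiral parameter `κ`. -/
def sector (κ : ℤ) : Submodule ℂ Fuzzy where
  carrier := {Ψ | ∃ c : Occ × Occ → ℂ,
    (∀ p, c p ≠ 0 → chirality p.1 p.2 = κ) ∧ HasExpansion c Ψ}
  zero_mem' := ⟨0, by simp, fun v => by simp [Function.support]⟩
  add_mem' := by
    rintro Ψ Φ ⟨c, hc, hΨ⟩ ⟨e, he, hΦ⟩
    refine ⟨c + e, fun p hp => ?_, fun v => ?_⟩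
    · by_cases h : c p = 0
      · exact he p fun h' => hp (by simp [h, h'])
      · exact hc p h
    · have key : (fun p : Occ × Occ => (c + e) p • monomial p.1 p.2 v) =
          fun p => c p • monomial p.1 p.2 v + e p • monomial p.1 p.2 v := by
        funext p
        simp [add_smul]
      rw [key]
      refine ⟨((hΨ v).1.union (hΦ v).1).subset (Function.support_add _ _), ?_⟩
      rw [finsum_add_distrib (hΨ v).1 (hΦ v).1, LinearMap.add_apply, (hΨ v).2, (hΦ v).2]
  smul_mem' := by
    rintro z Ψ ⟨c, hc, hΨ⟩
    refine ⟨z • c, fun p hp => hc p fun h => hp (by simp [h]), fun v => ?_⟩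
    have key : (fun p : Occ × Occ => (z • c) p • monomial p.1 p.2 v) =
        fun p => z • (c p • monomial p.1 p.2 v) := by
      funext p
      simp [mul_smul]
    rw [key]
    refine ⟨(hΨ v).1.subset fun p hp h => hp (by simp only [h, smul_zero]), ?_⟩
    rw [← smul_finsum, LinearMap.smul_apply, (hΨ v).2]

/-- The matrix element `⟨m| Ψ |n⟩`; the states `ket` are orthonormal. -/
def matElem (Ψ : Fuzzy) (m n : Occ) : ℂ := ketBasis.repr (Ψ (ket n)) m

/-- `Ψ` is Hilbert–Schmidt. -/
def IsHS (Ψ : Fuzzy) : Prop :=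
  Summable fun p : Occ × Occ => ‖matElem Ψ p.1 p.2‖ ^ 2

/-- The Hilbert–Schmidt product `⟨Ψ, Φ⟩ = Tr(Ψ† Φ)`. -/
def hsInner (Ψ Φ : Fuzzy) : ℂ :=
  ∑' p : Occ × Occ, (starRingEnd ℂ) (matElem Ψ p.1 p.2) * matElem Φ p.1 p.2

/-! ### The Lie algebra `su(2,2)` and its generators -/

/-- Complex `4 × 4` matrices in `2 × 2` blocks. -/
abbrev Mat : Type := Matrix (Fin 2 ⊕ Fin 2) (Fin 2 ⊕ Fin 2) ℂ

/-- The hermitian form `Γ = diag(1, 1, -1, -1)`. -/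
def Gam : Mat := Matrix.fromBlocks 1 0 0 (-1)

/-- The real Lie algebra `su(2,2)`. -/
def su22 : LieSubalgebra ℝ Mat where
  carrier := {X | X.conjTranspose * Gam + Gam * X = 0 ∧ X.trace = 0}
  zero_mem' := by simp
  add_mem' := by
    rintro X Y ⟨hX, tX⟩ ⟨hY, tY⟩
    refine ⟨?_, by rw [Matrix.trace_add, tX, tY, add_zero]⟩
    have : (X + Y).conjTranspose * Gam + Gam * (X + Y) =
        (X.conjTranspose * Gam + Gam * X) + (Y.conjTranspose * Gam + Gam * Y) := by
      rw [Matrix.conjTranspose_add]; noncomm_ring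
    rw [this, hX, hY, add_zero]
  smul_mem' := by
    rintro r X ⟨hX, tX⟩
    refine ⟨?_, by rw [Matrix.trace_smul, tX, smul_zero]⟩
    have : (r • X).conjTranspose * Gam + Gam * (r • X) =
        r • (X.conjTranspose * Gam + Gam * X) := by
      rw [Matrix.conjTranspose_smul, star_trivial, smul_add, Matrix.smul_mul, Matrix.mul_smul]
    rw [this, hX, smul_zero]
  lie_mem' := by
    rintro X Y ⟨hX, -⟩ ⟨hY, -⟩
    refine ⟨?_, by rw [Ring.lie_def, Matrix.trace_sub, Matrix.trace_mul_comm, sub_self]⟩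
    have hX' : X.conjTranspose * Gam = -(Gam * X) := eq_neg_of_add_eq_zero_left hX
    have hY' : Y.conjTranspose * Gam = -(Gam * Y) := eq_neg_of_add_eq_zero_left hY
    rw [Ring.lie_def, Matrix.conjTranspose_sub, Matrix.conjTranspose_mul,
      Matrix.conjTranspose_mul, sub_mul, mul_assoc, mul_assoc, hX', hY', mul_neg, mul_neg,
      ← mul_assoc, ← mul_assoc, hX', hY']
    noncomm_ring

/-- The Pauli matrices. -/
def pauli : Fin 3 → Matrix (Fin 2) (Fin 2) ℂ :=
  ![!![0, 1; 1, 0], !![0, -Complex.I; Complex.I, 0], !![1, 0; 0, -1]]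

/-- The metric `η = (+ - - -)`. -/
def eta : Fin 4 → ℂ := ![1, -1, -1, -1]

/-- The Dirac matrices `γ^μ` in the Dirac basis. -/
def gammaUp : Fin 4 → Mat :=
  Fin.cons (Matrix.fromBlocks 1 0 0 (-1))
    fun i => Matrix.fromBlocks 0 (pauli i) (-pauli i) 0

/-- The Dirac matrices with lower index, `γ_μ = η_{μμ} γ^μ`. -/
def gam (μ : Fin 4) : Mat := eta μ • gammaUp μ

/-- `γ_5 = -γ^5`, where `γ^5 = i γ^0 γ^1 γ^2 γ^3`. -/
def gam5 : Mat := -(Complex.I • (gammaUp 0 * gammaUp 1 * gammaUp 2 * gammaUp 3))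

/-- The generators `S_{μν}`. -/
def genS (μ ν : Fin 4) : Mat := (-(1 / 4) : ℂ) • (gam μ * gam ν - gam ν * gam μ)

/-- The generators `S_{μ4}`. -/
def genS4 (μ : Fin 4) : Mat := (Complex.I / 2) • (gam5 * gam μ)

/-- The generators `S_{μ5}`. -/
def genS5 (μ : Fin 4) : Mat := (-(Complex.I / 2)) • gam μ

/-- The momenta `P_μ = S_{μ5} + S_{μ4}`. -/
def genP (μ : Fin 4) : Mat := genS5 μ + genS4 μ

/-- The compact subalgebra `su(2) ⊕ su(2)` of `su(2,2)`: block diagonal matrices with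
skew-hermitian traceless blocks. -/
def su2su2 : Set Mat :=
  {X | ∃ A B : Matrix (Fin 2) (Fin 2) ℂ, A.conjTranspose = -A ∧ A.trace = 0 ∧
    B.conjTranspose = -B ∧ B.trace = 0 ∧ X = Matrix.fromBlocks A 0 0 B}

/-! ### The oscillator representations -/

/-- The column `Â = (â_α, b̂^α)` of operators on `𝒜`: `â_α Ψ = a_α Ψ`, `b̂^α Ψ = Ψ a_α`. -/
def oscA : Fin 2 ⊕ Fin 2 → Module.End ℂ Fuzzy :=
  Sum.elim (fun α => LinearMap.mulLeft ℂ (ann α)) (fun α => LinearMap.mulRight ℂ (ann α))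

/-- The row `Â† = (â^{†α}, b̂†_α)`: `â^{†α} Ψ = a^{†α} Ψ`, `b̂†_α Ψ = Ψ a^{†α}`. -/
def oscAdag : Fin 2 ⊕ Fin 2 → Module.End ℂ Fuzzy :=
  Sum.elim (fun α => LinearMap.mulLeft ℂ (cre α)) (fun α => LinearMap.mulRight ℂ (cre α))

/-- The fundamental oscillator representation `X̂ = Â† Γ X Â`. -/
def fundRep (X : Mat) : Module.End ℂ Fuzzy :=
  ∑ i, ∑ j, (Gam * X) i j • (oscAdag i * oscA j)

/-- The dual oscillator representation `X̃ = Ã† Γ X' Ã` with `X' = -Xᵀ`. -/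
def dualRep (X : Mat) : Module.End ℂ Fuzzy := fundRep (-X.transpose)

/-! ### Invariants of a representation `R` by operators on `𝒜` -/

section

variable (R : Mat → Module.End ℂ Fuzzy)

/-- `V` is invariant under the operators `R X`, `X ∈ 𝔤`. -/
def IsInvariant (𝔤 : Set Mat) (V : Submodule ℂ Fuzzy) : Prop :=
  ∀ X ∈ 𝔤, ∀ Ψ ∈ V, R X Ψ ∈ V

/-- `V` is invariant and irreducible under the operators `R X`, `X ∈ 𝔤`. -/
def IsIrred (𝔤 : Set Mat) (V : Submodule ℂ Fuzzy) : Prop :=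
  IsInvariant R 𝔤 V ∧ V ≠ ⊥ ∧
    ∀ U : Submodule ℂ Fuzzy, U ≤ V → IsInvariant R 𝔤 U → U = ⊥ ∨ U = V

/-- The Levi-Civita symbol with `ε_{0123} = 1`. -/
def levi (μ ν ρ σ : Fin 4) : ℂ :=
  (Matrix.of fun i j : Fin 4 => if ![μ, ν, ρ, σ] i = j then (1 : ℂ) else 0).det

/-- `P² = P_μ P^μ`. -/
def massSq : Module.End ℂ Fuzzy := ∑ μ, eta μ • (R (genP μ) * R (genP μ))

/-- The Pauli–Lubanski vector `W_μ = ½ ε_{μνρσ} S^{νρ} P^σ`. -/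
def pauliLub (μ : Fin 4) : Module.End ℂ Fuzzy :=
  (1 / 2 : ℂ) • ∑ ν, ∑ ρ, ∑ σ,
    (levi μ ν ρ σ * eta ν * eta ρ * eta σ) • (R (genS ν ρ) * R (genP σ))

/-- `W² = W_μ W^μ`. -/
def pauliLubSq : Module.End ℂ Fuzzy := ∑ μ, eta μ • (pauliLub R μ * pauliLub R μ)

/-- `V` has helicity `h`: `W_μ = h P_μ` on `V` for the hermitian (physical) generators
`i S_{μν}`, `i P_μ`. In terms of the anti-hermitian ones this reads `-W_μ = h (i P_μ)`. -/
def HasHelicity (V : Submodule ℂ Fuzzy) (h : ℝ) : Prop :=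
  ∀ μ, ∀ Ψ ∈ V, -(pauliLub R μ Ψ) = (h : ℂ) • Complex.I • R (genP μ) Ψ

/-- The conformal energy operator `i S_{05}`. -/
def energy : Module.End ℂ Fuzzy := Complex.I • R (genS5 0)

/-- The eigenvalues of the operator `H` with an eigenvector in `V`. -/
def eigenvaluesOn (H : Module.End ℂ Fuzzy) (V : Submodule ℂ Fuzzy) : Set ℂ :=
  {E | ∃ Ψ ∈ V, Ψ ≠ 0 ∧ H Ψ = E • Ψ}

/-- The span of the eigenvectors of `H` in `V`. -/
def finiteVectors (H : Module.End ℂ Fuzzy) (V : Submodule ℂ Fuzzy) : Submodule ℂ Fuzzy :=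
  Submodule.span ℂ {Ψ | Ψ ∈ V ∧ ∃ E : ℂ, H Ψ = E • Ψ}

/-- The eigenvectors of `H` in `V` with eigenvalue `E`, together with `0`. -/
def eigenspaceIn (H : Module.End ℂ Fuzzy) (V : Submodule ℂ Fuzzy) (E : ℂ) :
    Submodule ℂ Fuzzy :=
  V ⊓ LinearMap.ker (H - E • LinearMap.id)

/-- The Casimir operator `J₁² + J₂² + J₃²` of the first `su(2)`, with `J_k = σ_k / 2`. -/
def casimirLeft : Module.End ℂ Fuzzy :=
  ∑ k, R (Matrix.fromBlocks ((1 / 2 : ℂ) • pauli k) 0 0 0) *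
    R (Matrix.fromBlocks ((1 / 2 : ℂ) • pauli k) 0 0 0)

/-- The Casimir operator `J₁² + J₂² + J₃²` of the second `su(2)`. -/
def casimirRight : Module.End ℂ Fuzzy :=
  ∑ k, R (Matrix.fromBlocks 0 0 0 ((1 / 2 : ℂ) • pauli k)) *
    R (Matrix.fromBlocks 0 0 0 ((1 / 2 : ℂ) • pauli k))

/-- `V` is the irreducible representation of `su(2) ⊕ su(2)` with spins `(j₁, j₂)`. -/
def HasSpins (V : Submodule ℂ Fuzzy) (j₁ j₂ : ℝ) : Prop :=
  IsIrred R su2su2 V ∧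
    (∀ Ψ ∈ V, casimirLeft R Ψ = ((j₁ * (j₁ + 1) : ℝ) : ℂ) • Ψ) ∧
    (∀ Ψ ∈ V, casimirRight R Ψ = ((j₂ * (j₂ + 1) : ℝ) : ℂ) • Ψ)

/-- `V` carries a unitary irreducible representation of `su(2,2)` which is a lowest weight
representation with respect to the energy operator `H` (which is `± i S_{05}`), with lowest
weight `(d; j₁, j₂)`: `V` consists of Hilbert–Schmidt operators, `su(2,2)` acts irreducibly and
by skew-hermitian operators for the Hilbert–Schmidt product, `V` is spanned by eigenvectors of
`H`, all eigenvalues are real with least one `d`, and the lowest eigenspace is the irreducible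
representation of `su(2) ⊕ su(2)` with spins `(j₁, j₂)`. -/
structure IsUnitaryLowestWeight (H : Module.End ℂ Fuzzy) (V : Submodule ℂ Fuzzy)
    (d j₁ j₂ : ℝ) : Prop where
  irred : IsIrred R su22 V
  hilbertSchmidt : ∀ Ψ ∈ V, IsHS Ψ
  unitary : ∀ X ∈ su22, ∀ Ψ ∈ V, ∀ Φ ∈ V, hsInner (R X Ψ) Φ = -hsInner Ψ (R X Φ)
  spanned : finiteVectors H V = V
  real : ∀ E ∈ eigenvaluesOn H V, E.im = 0
  lowest : IsLeast (Complex.re '' eigenvaluesOn H V) d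
  lowestSpins : HasSpins R (eigenspaceIn H V d) j₁ j₂

/-- The classical fuzzy massless field of chiral parameter `κ` in the representation `R`, with
helicity `h` and energy operator `H`. The space `sector κ` consists of the power series in the
monomials of chiral parameter `κ`, and `monoSpan κ` of the finite ones among them; inside
`sector κ` the span of the energy eigenvectors is Mack's representation with `j₁ = κ/2`,
`j₂ = 0`, `d = j₁ + j₂ + 1`. -/
structure IsMasslessField (κ : ℕ) (H : Module.End ℂ Fuzzy) (h : ℝ) : Prop where
  representation : ∃ φ : su22 →ₗ⁅ℝ⁆ Module.End ℂ Fuzzy, ∀ X : su22, φ X = R X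
  span_le : monoSpan κ ≤ sector κ
  span_irred : IsIrred R su22 (monoSpan κ)
  sector_invariant : IsInvariant R su22 (sector κ)
  massless : ∀ Ψ ∈ sector κ, massSq R Ψ = 0
  pauliLub_null : ∀ Ψ ∈ sector κ, pauliLubSq R Ψ = 0
  helicity : HasHelicity R (sector κ) h
  spectrum : eigenvaluesOn H (sector κ) =
    Set.range fun k : ℕ => ((1 + (κ : ℝ) / 2 + k : ℝ) : ℂ)
  doubleton : IsUnitaryLowestWeight R H (finiteVectors H (sector κ))
    (1 + (κ : ℝ) / 2) ((κ : ℝ) / 2) 0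

end

end FuzzyDoubleton

set_option linter.unusedSimpArgs false

namespace FuzzyDoubleton

/-! ### Unnormalised states -/

/-- The factorial `n₁! n₂!` of an occupation number. -/
def occFact (n : Occ) : ℕ := ∏ α, (n α).factorial

lemma occFact_pos (n : Occ) : 0 < occFact n :=
  Finset.prod_pos fun _ _ => Nat.factorial_pos _

lemma occFact_add_single (n : Occ) (α : Fin 2) :
    occFact (n + Pi.single α 1) = (n α + 1) * occFact n := by
  fin_cases α <;> simp [occFact, Fin.prod_univ_two, Nat.factorial_succ] <;> ring

/-- An occupation number with `n_α > 0` arises from a smaller one by adding a quantum. -/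
lemma exists_add_single {n : Occ} {α : Fin 2} (h : n α ≠ 0) :
    ∃ m : Occ, n = m + Pi.single α 1 := by
  refine ⟨n - Pi.single α 1, ?_⟩
  funext β
  by_cases hb : β = α
  · subst hb; simp; omega
  · simp [hb]

lemma add_single_sub_single (n : Occ) (α : Fin 2) : n + Pi.single α 1 - Pi.single α 1 = n := by
  funext β; simp

/-- The total occupation number. -/
def tot (n : Occ) : ℕ := n 0 + n 1

@[simp] lemma tot_zero : tot 0 = 0 := rfl

@[simp] lemma tot_add_single (n : Occ) (α : Fin 2) : tot (n + Pi.single α 1) = tot n + 1 := by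
  fin_cases α <;> simp [tot] <;> ring

/-- The unnormalised state `(a†)ⁿ|0⟩`. -/
def mket (n : Occ) : Fock := ((√(occFact n : ℝ) : ℝ) : ℂ) • ket n

/-- The unnormalised dual state `⟨0|aⁿ`. -/
def mbra (n : Occ) : Fock →ₗ[ℂ] ℂ := ((√(occFact n : ℝ) : ℝ) : ℂ) • ketBasis.coord n

lemma sqrt_occFact_ne_zero (n : Occ) : ((√(occFact n : ℝ) : ℝ) : ℂ) ≠ 0 := by
  have h : (0 : ℝ) < occFact n := by exact_mod_cast occFact_pos n
  exact_mod_cast (Real.sqrt_pos.2 h).ne'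

lemma ann_ket (α : Fin 2) (n : Occ) :
    ann α (ket n) = ((√(n α : ℝ) : ℝ) : ℂ) • ket (n - Pi.single α 1) := by
  simp [ann, ket, Module.Basis.constr_basis]

lemma cre_ket (α : Fin 2) (n : Occ) :
    cre α (ket n) = ((√((n α : ℝ) + 1) : ℝ) : ℂ) • ket (n + Pi.single α 1) := by
  simp [cre, ket, Module.Basis.constr_basis]

lemma cre_mket (α : Fin 2) (n : Occ) : cre α (mket n) = mket (n + Pi.single α 1) := by
  rw [mket, mket, map_smul, cre_ket, smul_smul, ← Complex.ofReal_mul,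
    ← Real.sqrt_mul (by positivity), occFact_add_single]
  push_cast
  rw [mul_comm]

lemma ann_mket_add (α : Fin 2) (n : Occ) :
    ann α (mket (n + Pi.single α 1)) = ((n α : ℂ) + 1) • mket n := by
  rw [mket, mket, map_smul, ann_ket, smul_smul, smul_smul, add_single_sub_single,
    occFact_add_single]
  congr 1
  have h : (0 : ℝ) ≤ n α + 1 := by positivity
  have h2 : ((n + Pi.single α 1 : Occ) α : ℝ) = n α + 1 := by simp
  rw [h2]
  have h3 : ((√((n α : ℝ) + 1) : ℝ) : ℂ) * ((√((n α : ℝ) + 1) : ℝ) : ℂ) = (n α : ℂ) + 1 := by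
    rw [← Complex.ofReal_mul, Real.mul_self_sqrt h]
    push_cast
    rfl
  push_cast
  rw [Real.sqrt_mul h, Complex.ofReal_mul, mul_right_comm, h3]

lemma ann_mket_of_eq_zero {α : Fin 2} {n : Occ} (h : n α = 0) : ann α (mket n) = 0 := by
  simp [mket, ann_ket, h]

lemma ann_mket (α : Fin 2) (n : Occ) :
    ann α (mket n) = (n α : ℂ) • mket (n - Pi.single α 1) := by
  by_cases h : n α = 0
  · simp [ann_mket_of_eq_zero h, h]
  · obtain ⟨m, rfl⟩ := exists_add_single h
    rw [ann_mket_add, add_single_sub_single]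
    simp

lemma fock_hom_ext {M : Type*} [AddCommGroup M] [Module ℂ M] {f g : Fock →ₗ[ℂ] M}
    (h : ∀ n, f (mket n) = g (mket n)) : f = g := by
  refine ketBasis.ext fun n => ?_
  have := h n
  rw [mket, map_smul, map_smul] at this
  exact smul_right_injective M (sqrt_occFact_ne_zero n) this

lemma mbra_mket (p q : Occ) : mbra p (mket q) = if p = q then (occFact q : ℂ) else 0 := by
  rw [mbra, mket]
  simp only [LinearMap.smul_apply, map_smul, ket, Module.Basis.coord_apply,
    Module.Basis.repr_self, smul_eq_mul, Finsupp.single_apply]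
  by_cases h : q = p
  · subst h
    simp only [if_true, mul_one]
    rw [← Complex.ofReal_mul, Real.mul_self_sqrt (by positivity)]
    simp
  · simp [h, Ne.symm h]

lemma mbra_comp_ann (α : Fin 2) (q : Occ) : mbra q ∘ₗ ann α = mbra (q + Pi.single α 1) := by
  refine fock_hom_ext fun n => ?_
  by_cases h : n α = 0
  · rw [LinearMap.comp_apply, ann_mket_of_eq_zero h, map_zero, mbra_mket, if_neg]
    rintro rfl
    simp at h
  · obtain ⟨m, rfl⟩ := exists_add_single h
    rw [LinearMap.comp_apply, ann_mket_add, map_smul, mbra_mket, mbra_mket, occFact_add_single]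
    by_cases h : q = m <;> simp [h]

lemma mbra_comp_cre (α : Fin 2) (q : Occ) :
    mbra q ∘ₗ cre α = (q α : ℂ) • mbra (q - Pi.single α 1) := by
  refine fock_hom_ext fun n => ?_
  rw [LinearMap.comp_apply, cre_mket, mbra_mket, LinearMap.smul_apply, mbra_mket]
  by_cases h : q α = 0
  · rw [if_neg]
    · simp [h]
    · rintro rfl
      simp at h
  · obtain ⟨m, rfl⟩ := exists_add_single h
    rw [add_single_sub_single, occFact_add_single]
    by_cases h : m = n <;> simp [h]

/-! ### Canonical commutation relations -/

lemma cre_mul_comm (α β : Fin 2) : cre α * cre β = cre β * cre α :=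
  fock_hom_ext fun n => by
    simp only [Module.End.mul_apply, cre_mket]
    rw [add_right_comm]

lemma ann_mul_comm (α β : Fin 2) : ann α * ann β = ann β * ann α := by
  rcases eq_or_ne α β with rfl | h
  · rfl
  refine fock_hom_ext fun n => ?_
  simp only [Module.End.mul_apply, ann_mket, map_smul, smul_smul, Pi.sub_apply,
    Pi.single_eq_of_ne h, Pi.single_eq_of_ne h.symm, Nat.sub_zero, mul_comm]
  rw [tsub_right_comm]

lemma ann_mul_cre (α β : Fin 2) :
    ann α * cre β = cre β * ann α + (if α = β then 1 else 0 : ℂ) • 1 := by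
  refine fock_hom_ext fun n => ?_
  rcases eq_or_ne α β with rfl | h
  · simp only [Module.End.mul_apply, cre_mket, ann_mket_add, LinearMap.add_apply, if_true,
      one_smul, Module.End.one_apply]
    by_cases h : n α = 0
    · rw [ann_mket_of_eq_zero h]; simp [h]
    · obtain ⟨m, rfl⟩ := exists_add_single h
      rw [ann_mket_add, map_smul, cre_mket]
      simp [add_smul]
  · simp only [Module.End.mul_apply, cre_mket, if_neg h, zero_smul, add_zero]
    by_cases hn : n α = 0
    · rw [ann_mket_of_eq_zero hn, ann_mket_of_eq_zero (by simp [hn, h]), map_zero]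
    · obtain ⟨m, rfl⟩ := exists_add_single hn
      rw [add_right_comm, ann_mket_add, ann_mket_add, map_smul, cre_mket]
      simp [h]

lemma ann_mul_cre_self (α : Fin 2) : ann α * cre α = cre α * ann α + 1 := by
  simp [ann_mul_cre]

lemma ann_mul_cre_of_ne {α β : Fin 2} (h : α ≠ β) : ann α * cre β = cre β * ann α := by
  simp [ann_mul_cre, h]

/-! ### The grading of fuzzy functions by the number operator -/

/-- The total number operator on the Fock space. -/
def numOp : Fuzzy := ∑ α, cre α * ann α

lemma numOp_mket (n : Occ) : numOp (mket n) = (tot n : ℂ) • mket n := by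
  have key : ∀ α, (cre α * ann α) (mket n) = (n α : ℂ) • mket n := fun α => by
    by_cases h : n α = 0
    · rw [Module.End.mul_apply, ann_mket_of_eq_zero h]; simp [h]
    · obtain ⟨m, rfl⟩ := exists_add_single h
      rw [Module.End.mul_apply, ann_mket_add, map_smul, cre_mket]
      simp
  rw [numOp, LinearMap.sum_apply, Fin.sum_univ_two, key, key, ← add_smul, tot]
  push_cast
  rfl

/-- The fuzzy functions that raise the number operator by `κ`. -/
def grade (κ : ℂ) : Submodule ℂ Fuzzy :=
  LinearMap.ker (LinearMap.mulLeft ℂ numOp - LinearMap.mulRight ℂ numOp - κ • LinearMap.id)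

lemma mem_grade {κ : ℂ} {Ψ : Fuzzy} : Ψ ∈ grade κ ↔ numOp * Ψ = Ψ * numOp + κ • Ψ := by
  rw [grade, LinearMap.mem_ker]
  simp only [LinearMap.sub_apply, LinearMap.mulLeft_apply,
    LinearMap.mulRight_apply, LinearMap.smul_apply, LinearMap.id_apply]
  rw [sub_sub, sub_eq_zero]

lemma mul_mem_grade {κ l : ℂ} {Ψ Φ : Fuzzy} (hΨ : Ψ ∈ grade κ) (hΦ : Φ ∈ grade l) :
    Ψ * Φ ∈ grade (κ + l) := by
  rw [mem_grade] at *
  rw [← mul_assoc, hΨ, add_mul, mul_assoc, hΦ, mul_add, add_smul, mul_assoc]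
  simp only [smul_mul_assoc, mul_smul_comm]
  abel

lemma one_mem_grade : (1 : Fuzzy) ∈ grade 0 := by simp [mem_grade]

lemma pow_mem_grade {κ : ℂ} {Ψ : Fuzzy} (hΨ : Ψ ∈ grade κ) (n : ℕ) : Ψ ^ n ∈ grade (n * κ) := by
  induction n with
  | zero => simpa using one_mem_grade
  | succ n ih =>
    rw [pow_succ]
    convert mul_mem_grade ih hΨ using 2
    push_cast
    ring

lemma cre_mem_grade (α : Fin 2) : cre α ∈ grade 1 := by
  rw [mem_grade]
  refine fock_hom_ext fun n => ?_
  simp only [Module.End.mul_apply, cre_mket, numOp_mket, LinearMap.add_apply, one_smul,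
    map_smul, tot_add_single]
  push_cast
  rw [add_smul, one_smul]

lemma ann_mem_grade (α : Fin 2) : ann α ∈ grade (-1) := by
  rw [mem_grade]
  refine fock_hom_ext fun n => ?_
  by_cases h : n α = 0
  · simp [Module.End.mul_apply, numOp_mket, ann_mket_of_eq_zero h]
  · obtain ⟨m, rfl⟩ := exists_add_single h
    simp only [Module.End.mul_apply, ann_mket_add, numOp_mket, LinearMap.add_apply,
      map_smul, tot_add_single, LinearMap.smul_apply]
    push_cast
    module

/-- The states of total occupation number `r`. -/
def weightSpace (r : ℂ) : Submodule ℂ Fock := LinearMap.ker (numOp - r • LinearMap.id)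

lemma mem_weightSpace {r : ℂ} {v : Fock} : v ∈ weightSpace r ↔ numOp v = r • v := by
  simp [weightSpace, sub_eq_zero]

lemma mket_mem_weightSpace (n : Occ) : mket n ∈ weightSpace (tot n) :=
  mem_weightSpace.2 (numOp_mket n)

lemma apply_mem_weightSpace {κ r : ℂ} {Ψ : Fuzzy} (hΨ : Ψ ∈ grade κ) {v : Fock}
    (hv : v ∈ weightSpace r) : Ψ v ∈ weightSpace (r + κ) := by
  rw [mem_weightSpace] at *
  rw [mem_grade] at hΨ
  rw [← Module.End.mul_apply, hΨ, LinearMap.add_apply, Module.End.mul_apply, hv, map_smul,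
    LinearMap.smul_apply, add_smul]

lemma mem_grade_of_forall_mket {κ : ℂ} {Ψ : Fuzzy}
    (h : ∀ n, Ψ (mket n) ∈ weightSpace (tot n + κ)) : Ψ ∈ grade κ := by
  rw [mem_grade]
  refine fock_hom_ext fun n => ?_
  rw [Module.End.mul_apply, mem_weightSpace.1 (h n), LinearMap.add_apply, Module.End.mul_apply,
    numOp_mket, map_smul, LinearMap.smul_apply, add_smul]

lemma mbra_comp_numOp (p : Occ) : mbra p ∘ₗ numOp = (tot p : ℂ) • mbra p := by
  refine fock_hom_ext fun n => ?_
  rw [LinearMap.comp_apply, numOp_mket, map_smul, LinearMap.smul_apply, mbra_mket]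
  split_ifs with h
  · rw [h]
  · simp

lemma mbra_eq_zero_of_mem_weightSpace {r : ℂ} {v : Fock} (hv : v ∈ weightSpace r) {p : Occ}
    (hp : (tot p : ℂ) ≠ r) : mbra p v = 0 := by
  have h := LinearMap.congr_fun (mbra_comp_numOp p) v
  rw [LinearMap.comp_apply, mem_weightSpace.1 hv, map_smul, LinearMap.smul_apply, ← sub_eq_zero,
    ← sub_smul, smul_eq_zero, sub_eq_zero] at h
  exact h.resolve_left (Ne.symm hp)

lemma monomial_mem_grade (n m : Occ) : monomial n m ∈ grade (chirality n m) := by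
  have h := mul_mem_grade (mul_mem_grade (mul_mem_grade (pow_mem_grade (cre_mem_grade 0) (n 0))
    (pow_mem_grade (cre_mem_grade 1) (n 1))) (pow_mem_grade (ann_mem_grade 0) (m 0)))
    (pow_mem_grade (ann_mem_grade 1) (m 1))
  rw [monomial]
  convert h using 2
  simp only [chirality]
  push_cast
  ring

/-! ### Normal-ordered expansions -/

lemma finite_mbra_ne_zero (v : Fock) : {n | mbra n v ≠ 0}.Finite := by
  refine (ketBasis.repr v).support.finite_toSet.subset fun n hn => ?_
  simp only [Finset.mem_coe, Finsupp.mem_support_iff]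
  intro h
  exact hn (by simp [mbra, h])

lemma sum_mbra_smul_mket {S : Finset Occ} {v : Fock} (hS : ∀ n, mbra n v ≠ 0 → n ∈ S) :
    ∑ n ∈ S, ((occFact n : ℂ)⁻¹ * mbra n v) • mket n = v := by
  have hterm : ∀ n, ((occFact n : ℂ)⁻¹ * mbra n v) • mket n = ketBasis.repr v n • ketBasis n := by
    intro n
    have hs : ((√(occFact n : ℝ) : ℝ) : ℂ) * ((√(occFact n : ℝ) : ℝ) : ℂ) = occFact n := by
      rw [← Complex.ofReal_mul, Real.mul_self_sqrt (by positivity)]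
      simp
    have h0 := sqrt_occFact_ne_zero n
    rw [mbra, mket, smul_smul, ← hs, ket]
    congr 1
    simp only [LinearMap.smul_apply, Module.Basis.coord_apply, smul_eq_mul]
    field_simp
  simp_rw [hterm]
  conv_rhs => rw [← ketBasis.linearCombination_repr v, Finsupp.linearCombination_apply]
  refine (Finsupp.sum_of_support_subset _ (fun n hn => hS n ?_)
    (fun n z => z • ketBasis n) fun n _ => zero_smul ℂ (ketBasis n)).symm
  rw [mbra, LinearMap.smul_apply, smul_ne_zero_iff]
  exact ⟨sqrt_occFact_ne_zero n, by simpa using hn⟩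

lemma fock_induction {p : Fock → Prop} (hk : ∀ n, p (mket n))
    (hadd : ∀ v w, p v → p w → p (v + w)) (hsmul : ∀ (z : ℂ) v, p v → p (z • v)) (v : Fock) :
    p v := by
  rw [← sum_mbra_smul_mket (v := v) (S := (finite_mbra_ne_zero v).toFinset) (by simp)]
  refine Finset.sum_induction _ _ hadd ?_ fun n _ => hsmul _ _ (hk n)
  rw [← zero_smul ℂ (mket 0)]
  exact hsmul _ _ (hk 0)

lemma cre_pow_mket (α : Fin 2) (k : ℕ) (n : Occ) :
    (cre α ^ k) (mket n) = mket (n + Pi.single α k) := by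
  induction k generalizing n with
  | zero => simp
  | succ k ih =>
    rw [pow_succ, Module.End.mul_apply, cre_mket, ih, add_assoc, ← Pi.single_add, add_comm 1]

lemma ann_pow_mket (α : Fin 2) (k : ℕ) (n : Occ) :
    (ann α ^ k) (mket n) = ((n α).descFactorial k : ℂ) • mket (n - Pi.single α k) := by
  induction k with
  | zero => simp
  | succ k ih =>
    rw [pow_succ', Module.End.mul_apply, ih, map_smul, ann_mket, smul_smul, tsub_tsub,
      ← Pi.single_add, Nat.descFactorial_succ]
    simp [mul_comm]

/-- The product of creation operators `(a^{†1})^{n₁} (a^{†2})^{n₂}`. -/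
def crePow (n : Occ) : Fuzzy := cre 0 ^ n 0 * cre 1 ^ n 1

lemma occ_eq (n : Occ) : n = Pi.single 0 (n 0) + Pi.single 1 (n 1) := by
  funext α; fin_cases α <;> simp

lemma crePow_mket (n m : Occ) : crePow n (mket m) = mket (m + n) := by
  rw [crePow, Module.End.mul_apply, cre_pow_mket, cre_pow_mket, add_assoc,
    add_comm (Pi.single 1 _), ← occ_eq]

lemma monomial_mket (n m q : Occ) : monomial n m (mket q) =
    (((q 0).descFactorial (m 0) * (q 1).descFactorial (m 1) : ℕ) : ℂ) • mket (q - m + n) := by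
  have h : q - m = q - Pi.single 1 (m 1) - Pi.single 0 (m 0) := by
    rw [tsub_tsub, add_comm, ← occ_eq]
  rw [monomial, mul_assoc, Module.End.mul_apply, ← crePow, Module.End.mul_apply, ann_pow_mket,
    map_smul, ann_pow_mket, smul_smul, map_smul, crePow_mket, h]
  congr 1
  simp [mul_comm]

/-- The derivation `Ψ ↦ Ψ a^{†α} - a^{†α} Ψ`. -/
def adCre (α : Fin 2) : Module.End ℂ Fuzzy :=
  LinearMap.mulRight ℂ (cre α) - LinearMap.mulLeft ℂ (cre α)

lemma adCre_mem_grade {κ : ℂ} {Ψ : Fuzzy} (hΨ : Ψ ∈ grade κ) (α : Fin 2) :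
    adCre α Ψ ∈ grade (κ + 1) := by
  refine Submodule.sub_mem _ (mul_mem_grade hΨ (cre_mem_grade α)) ?_
  rw [add_comm]
  exact mul_mem_grade (cre_mem_grade α) hΨ

lemma adCre_pow_mem_grade {κ : ℂ} {Ψ : Fuzzy} (hΨ : Ψ ∈ grade κ) (α : Fin 2) (k : ℕ) :
    (adCre α ^ k) Ψ ∈ grade (κ + k) := by
  induction k with
  | zero => simpa using hΨ
  | succ k ih =>
    rw [pow_succ', Module.End.mul_apply]
    convert adCre_mem_grade ih α using 2
    push_cast
    ring

lemma mulLeft_adCre_commute (α β : Fin 2) :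
    Commute (LinearMap.mulLeft ℂ (cre α)) (adCre β) := by
  refine LinearMap.ext fun Ψ => ?_
  simp only [adCre, Module.End.mul_apply, LinearMap.sub_apply, LinearMap.mulLeft_apply,
    LinearMap.mulRight_apply, mul_sub, ← mul_assoc, cre_mul_comm α β]

lemma mul_cre_pow (α : Fin 2) (k : ℕ) (Ψ : Fuzzy) :
    Ψ * cre α ^ k =
      ∑ m ∈ Finset.range (k + 1), (k.choose m : ℂ) • (cre α ^ (k - m) * (adCre α ^ m) Ψ) := by
  have h : (LinearMap.mulRight ℂ (cre α)) ^ k =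
      ∑ m ∈ Finset.range (k + 1), adCre α ^ m * LinearMap.mulLeft ℂ (cre α) ^ (k - m) *
        (k.choose m : Module.End ℂ Fuzzy) := by
    rw [← (mulLeft_adCre_commute α α).symm.add_pow]
    simp [adCre]
  have h2 := LinearMap.congr_fun h Ψ
  rw [LinearMap.pow_mulRight, LinearMap.mulRight_apply] at h2
  rw [h2, LinearMap.sum_apply]
  refine Finset.sum_congr rfl fun m _ => ?_
  rw [((mulLeft_adCre_commute α α).symm.pow_pow m (k - m)).eq, ← Nat.cast_comm,
    Module.End.mul_apply, Module.End.mul_apply, LinearMap.pow_mulLeft, LinearMap.mulLeft_apply,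
    Module.End.natCast_apply, Nat.cast_smul_eq_nsmul]

/-- The vector `∑ n, c n m • (a†)ⁿ|0⟩` of coefficients of `aᵐ / m!` in the normal-ordered
expansion of `Ψ`. -/
def symbolVec (Ψ : Fuzzy) (m : Occ) : Fock := ((adCre 1 ^ m 1) ((adCre 0 ^ m 0) Ψ)) (mket 0)

lemma symbolVec_mem_weightSpace {κ : ℂ} {Ψ : Fuzzy} (hΨ : Ψ ∈ grade κ) (m : Occ) :
    symbolVec Ψ m ∈ weightSpace (κ + tot m) := by
  have h := apply_mem_weightSpace
    (adCre_pow_mem_grade (adCre_pow_mem_grade hΨ 0 (m 0)) 1 (m 1)) (mket_mem_weightSpace 0)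
  rw [symbolVec]
  convert h using 2
  simp [tot, add_assoc]

lemma sum_Iic_occ {M : Type*} [AddCommMonoid M] (q : Occ) (f : Occ → M) :
    ∑ m ∈ Finset.Iic q, f m =
      ∑ i ∈ Finset.range (q 0 + 1), ∑ j ∈ Finset.range (q 1 + 1), f ![i, j] := by
  rw [← Finset.sum_product']
  refine Finset.sum_bij' (fun m _ => (m 0, m 1)) (fun p _ => ![p.1, p.2]) ?_ ?_ ?_ ?_ ?_
  · intro m hm
    have := Finset.mem_Iic.1 hm
    simp [this 0, this 1]
  · intro p hp
    simp only [Finset.mem_product, Finset.mem_range, Nat.lt_succ_iff] at hp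
    rw [Finset.mem_Iic]
    intro α
    fin_cases α
    · exact hp.1
    · exact hp.2
  · intro m _
    funext α; fin_cases α <;> rfl
  · intro p _
    rfl
  · intro m _
    congr 1
    funext α; fin_cases α <;> rfl

lemma apply_mket_eq_sum (Ψ : Fuzzy) (q : Occ) :
    Ψ (mket q) = ∑ m ∈ Finset.Iic q,
      (((q 0).choose (m 0) * (q 1).choose (m 1) : ℕ) : ℂ) • crePow (q - m) (symbolVec Ψ m) := by
  have h : mket q = (cre 0 ^ q 0 * cre 1 ^ q 1) (mket 0) := by
    rw [← crePow, crePow_mket, zero_add]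
  rw [sum_Iic_occ, h, ← Module.End.mul_apply, ← mul_assoc, mul_cre_pow 0,
    Finset.sum_mul, LinearMap.sum_apply]
  refine Finset.sum_congr rfl fun i _ => ?_
  rw [smul_mul_assoc, mul_assoc, mul_cre_pow 1, Finset.mul_sum, Finset.smul_sum,
    LinearMap.sum_apply]
  refine Finset.sum_congr rfl fun j _ => ?_
  rw [mul_smul_comm, smul_smul, LinearMap.smul_apply, ← mul_assoc, Module.End.mul_apply]
  simp [crePow, symbolVec]

lemma crePow_apply_eq_sum {S : Finset Occ} {v : Fock} (hS : ∀ n, mbra n v ≠ 0 → n ∈ S)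
    (k : Occ) :
    crePow k v = ∑ n ∈ S, ((occFact n : ℂ)⁻¹ * mbra n v) • mket (k + n) := by
  conv_lhs => rw [← sum_mbra_smul_mket hS]
  rw [map_sum]
  refine Finset.sum_congr rfl fun n _ => ?_
  rw [map_smul, crePow_mket, add_comm]

/-- The coefficients of the normal-ordered expansion. -/
def symbolCoeff (Ψ : Fuzzy) (p : Occ × Occ) : ℂ :=
  (occFact p.2 : ℂ)⁻¹ * ((occFact p.1 : ℂ)⁻¹ * mbra p.1 (symbolVec Ψ p.2))

lemma expansion_apply_mket (Ψ : Fuzzy) (q : Occ) :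
    (Function.support fun p => symbolCoeff Ψ p • monomial p.1 p.2 (mket q)).Finite ∧
      Ψ (mket q) = ∑ᶠ p, symbolCoeff Ψ p • monomial p.1 p.2 (mket q) := by
  classical
  let S : Finset Occ := (Finset.Iic q).biUnion fun m =>
    (finite_mbra_ne_zero (symbolVec Ψ m)).toFinset
  have hS : ∀ m ∈ Finset.Iic q, ∀ n, mbra n (symbolVec Ψ m) ≠ 0 → n ∈ S := fun m hm n hn =>
    Finset.mem_biUnion.2 ⟨m, hm, by simpa using hn⟩
  have hsupp : (Function.support fun p => symbolCoeff Ψ p • monomial p.1 p.2 (mket q)) ⊆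
      (S ×ˢ Finset.Iic q : Finset (Occ × Occ)) := by
    rintro ⟨n, m⟩ hp
    have hm : m ∈ Finset.Iic q := by
      rw [Finset.mem_Iic]
      by_contra hm
      refine hp ?_
      have h : q 0 < m 0 ∨ q 1 < m 1 := by
        rw [Pi.le_def, Fin.forall_fin_two] at hm
        omega
      simp only [monomial_mket]
      rcases h with h | h
      · simp [Nat.descFactorial_of_lt h]
      · simp [Nat.descFactorial_of_lt h]
    refine Finset.mem_coe.2 (Finset.mem_product.2 ⟨hS m hm n fun h => hp ?_, hm⟩)
    simp [symbolCoeff, h]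
  refine ⟨(Finset.finite_toSet _).subset hsupp, ?_⟩
  rw [finsum_eq_sum_of_support_subset _ hsupp, Finset.sum_product_right, apply_mket_eq_sum]
  refine Finset.sum_congr rfl fun m hm => ?_
  rw [crePow_apply_eq_sum (hS m hm), Finset.smul_sum]
  refine Finset.sum_congr rfl fun n _ => ?_
  rw [monomial_mket, smul_smul, smul_smul, symbolCoeff]
  congr 1
  have h0 : ((m 0).factorial : ℂ) ≠ 0 := by exact_mod_cast (Nat.factorial_pos _).ne'
  have h1 : ((m 1).factorial : ℂ) ≠ 0 := by exact_mod_cast (Nat.factorial_pos _).ne'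
  have h : (occFact m : ℂ) = (m 0).factorial * (m 1).factorial := by
    simp [occFact, Fin.prod_univ_two]
  rw [h, Nat.descFactorial_eq_factorial_mul_choose, Nat.descFactorial_eq_factorial_mul_choose]
  push_cast
  field_simp

lemma hasExpansion_symbolCoeff (Ψ : Fuzzy) : HasExpansion (symbolCoeff Ψ) Ψ := by
  intro v
  refine fock_induction (p := fun v =>
    (Function.support fun p => symbolCoeff Ψ p • monomial p.1 p.2 v).Finite ∧
      Ψ v = ∑ᶠ p, symbolCoeff Ψ p • monomial p.1 p.2 v) ?_ ?_ ?_ v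
  · exact expansion_apply_mket Ψ
  · rintro v w ⟨hv, ev⟩ ⟨hw, ew⟩
    have key : (fun p : Occ × Occ => symbolCoeff Ψ p • monomial p.1 p.2 (v + w)) =
        fun p => symbolCoeff Ψ p • monomial p.1 p.2 v + symbolCoeff Ψ p • monomial p.1 p.2 w := by
      funext p
      rw [map_add, smul_add]
    rw [key]
    refine ⟨(hv.union hw).subset (Function.support_add _ _), ?_⟩
    rw [finsum_add_distrib hv hw, map_add, ev, ew]
  · rintro z v ⟨hv, ev⟩
    have key : (fun p : Occ × Occ => symbolCoeff Ψ p • monomial p.1 p.2 (z • v)) =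
        fun p => z • (symbolCoeff Ψ p • monomial p.1 p.2 v) := by
      funext p
      rw [map_smul, smul_comm]
    rw [key]
    refine ⟨hv.subset fun p hp h => hp (by simp only [h, smul_zero]), ?_⟩
    rw [← smul_finsum, map_smul, ev]

/-- The power series of chiral parameter `κ` are the fuzzy functions which raise the number
operator by `κ`. -/
lemma sector_eq_grade (κ : ℤ) : sector κ = grade κ := by
  refine le_antisymm ?_ fun Ψ hΨ => ?_
  · rintro Ψ ⟨c, hc, hΨ⟩
    refine mem_grade_of_forall_mket fun n => ?_
    rw [(hΨ (mket n)).2]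
    refine finsum_induction (· ∈ weightSpace (tot n + κ)) (Submodule.zero_mem _)
      (fun _ _ => Submodule.add_mem _) fun p => ?_
    by_cases hp : c p = 0
    · rw [hp, zero_smul]
      exact Submodule.zero_mem _
    · refine Submodule.smul_mem _ _ (apply_mem_weightSpace ?_ (mket_mem_weightSpace n))
      rw [← hc p hp]
      exact monomial_mem_grade p.1 p.2
  · refine ⟨symbolCoeff Ψ, fun p hp => ?_, hasExpansion_symbolCoeff Ψ⟩
    by_contra h
    refine hp ?_
    rw [symbolCoeff, mbra_eq_zero_of_mem_weightSpace (symbolVec_mem_weightSpace hΨ p.2), mul_zero,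
      mul_zero]
    intro h2
    apply h
    have h3 : (tot p.1 : ℤ) = κ + tot p.2 := by exact_mod_cast h2
    simp only [tot, chirality] at *
    push_cast at h3
    linarith

/-! ### Ladder systems -/

/-- A submodule of the span of joint eigenvectors `e i`, `i ∈ S`, of operators `T k` which separate
`S` contains one of the `e i` if it is non-zero and stable under the `T k`. -/
lemma exists_eigenvector_mem {ι κ W : Type*} [AddCommGroup W] [Module ℂ W] {e : ι → W}
    {T : κ → Module.End ℂ W} {c : κ → ι → ℂ} (hT : ∀ k i, T k (e i) = c k i • e i) {S : Set ι}
    (hS : ∀ i ∈ S, ∀ j ∈ S, i ≠ j → ∃ k, c k i ≠ c k j) {U : Submodule ℂ W}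
    (hU : ∀ k, ∀ u ∈ U, T k u ∈ U) (hle : U ≤ Submodule.span ℂ (e '' S)) (hbot : U ≠ ⊥) :
    ∃ i ∈ S, e i ∈ U := by
  classical
  have key : ∀ (n : ℕ) (f : ι →₀ ℂ), f.support.card ≤ n → (f.support : Set ι) ⊆ S →
      Finsupp.linearCombination ℂ e f ∈ U → Finsupp.linearCombination ℂ e f ≠ 0 →
      ∃ i ∈ S, e i ∈ U := by
    intro n
    induction n with
    | zero =>
      intro f hf _ _ h0
      rw [Nat.le_zero, Finset.card_eq_zero, Finsupp.support_eq_empty] at hf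
      simp [hf] at h0
    | succ n ih =>
      intro f hf hfS hfU h0
      have hne : f.support.Nonempty := by
        rw [Finset.nonempty_iff_ne_empty]
        intro h
        rw [Finsupp.support_eq_empty] at h
        simp [h] at h0
      obtain ⟨i, hi⟩ := hne
      by_cases hj : ∃ j ∈ f.support, j ≠ i
      · obtain ⟨j, hj, hji⟩ := hj
        obtain ⟨k, hk⟩ := hS i (hfS hi) j (hfS hj) hji.symm
        have hTf : ∀ g : ι →₀ ℂ, T k (Finsupp.linearCombination ℂ e g) =
            g.sum fun l z => (z * c k l) • e l := by
          intro g
          rw [Finsupp.linearCombination_apply, map_finsuppSum]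
          refine Finsupp.sum_congr fun l _ => ?_
          rw [map_smul, hT, smul_smul]
        have step : ∀ l ∈ f.support,
            T k (Finsupp.linearCombination ℂ e f) - c k l • Finsupp.linearCombination ℂ e f ≠ 0 →
            ∃ i ∈ S, e i ∈ U := by
          intro l hl hl0
          let g : ι →₀ ℂ := Finsupp.onFinset (f.support.erase l) (fun r => f r * (c k r - c k l))
            (by
              intro r hr
              rw [Finset.mem_erase, Finsupp.mem_support_iff]
              refine ⟨?_, left_ne_zero_of_mul hr⟩
              rintro rfl
              simp at hr)
          have hgs : g.support ⊆ f.support.erase l := Finsupp.support_onFinset_subset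
          have hg : Finsupp.linearCombination ℂ e g =
              T k (Finsupp.linearCombination ℂ e f) -
                c k l • Finsupp.linearCombination ℂ e f := by
            rw [hTf, Finsupp.linearCombination_apply, Finsupp.linearCombination_apply,
              Finsupp.smul_sum, ← Finsupp.sum_sub,
              Finsupp.sum_of_support_subset g (hgs.trans (Finset.erase_subset _ _)) _ (by simp),
              Finsupp.sum]
            refine Finset.sum_congr rfl fun r _ => ?_
            change (f r * (c k r - c k l)) • e r = _
            module
          refine ih g ?_ ?_ ?_ (hg ▸ hl0)
          · have h1 := Finset.card_le_card hgs
            rw [Finset.card_erase_of_mem hl] at h1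
            omega
          · intro r hr
            exact hfS (Finset.mem_of_mem_erase (hgs hr))
          · rw [hg]
            exact U.sub_mem (hU k _ hfU) (U.smul_mem _ hfU)
        by_cases hz : T k (Finsupp.linearCombination ℂ e f) -
            c k i • Finsupp.linearCombination ℂ e f = 0
        · refine step j hj ?_
          rw [sub_eq_zero.1 hz, ← sub_smul]
          exact smul_ne_zero (sub_ne_zero.2 hk) h0
        · exact step i hi hz
      · push Not at hj
        have hfe : f = Finsupp.single i (f i) := by
          ext l
          by_cases hl : l = i
          · subst hl; simp
          · rw [Finsupp.single_eq_of_ne hl]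
            by_contra h
            exact hl (hj l (Finsupp.mem_support_iff.2 h))
        refine ⟨i, hfS hi, ?_⟩
        rw [hfe, Finsupp.linearCombination_single] at hfU
        exact (U.smul_mem_iff (Finsupp.mem_support_iff.1 hi)).1 hfU
  obtain ⟨u, hu, hu0⟩ := U.exists_mem_ne_zero_of_ne_bot hbot
  obtain ⟨f, hf, rfl⟩ := (Finsupp.mem_span_image_iff_linearCombination ℂ).1 (hle hu)
  exact key _ f le_rfl hf hu hu0

/-- Vectors `e p q` on which the operators `x`, `y` and `dx`, `dy` act as multiplication by, and
derivatives with respect to, the variables on the monomials `xᵖ y^q`. -/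
structure IsLadder {W : Type*} [AddCommGroup W] [Module ℂ W] (e : Occ → Occ → W)
    (x dx y dy : Fin 2 → Module.End ℂ W) : Prop where
  x_apply : ∀ α p q, x α (e p q) = e (p + Pi.single α 1) q
  dx_apply : ∀ α p q, dx α (e p q) = (p α : ℂ) • e (p - Pi.single α 1) q
  y_apply : ∀ α p q, y α (e p q) = e p (q + Pi.single α 1)
  dy_apply : ∀ α p q, dy α (e p q) = (q α : ℂ) • e p (q - Pi.single α 1)

/-- The span of the vectors `e p q` of chiral parameter `κ`. -/
def ladderSpan {W : Type*} [AddCommGroup W] [Module ℂ W] (e : Occ → Occ → W) (κ : ℤ) :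
    Submodule ℂ W :=
  Submodule.span ℂ {Ψ | ∃ n m : Occ, chirality n m = κ ∧ Ψ = e n m}

lemma chirality_eq (n m : Occ) : chirality n m = tot n - tot m := by
  simp [chirality, tot]

lemma exists_ne_zero_of_tot_pos {n : Occ} (h : 0 < tot n) : ∃ α, n α ≠ 0 := by
  by_contra! h'
  simp [tot, h'] at h

lemma tot_eq_zero {n : Occ} (h : tot n = 0) : n = 0 := by
  funext α
  simp only [tot] at h
  fin_cases α
  · change n 0 = 0; omega
  · change n 1 = 0; omega

namespace IsLadder

variable {W : Type*} [AddCommGroup W] [Module ℂ W] {e : Occ → Occ → W}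
  {x dx y dy : Fin 2 → Module.End ℂ W}

lemma mem_ladderSpan {κ : ℤ} {p q : Occ} (h : chirality p q = κ) : e p q ∈ ladderSpan e κ :=
  Submodule.subset_span ⟨p, q, h, rfl⟩

lemma map_ladderSpan {κ l : ℤ} {T : Module.End ℂ W}
    (h : ∀ p q, chirality p q = κ → T (e p q) ∈ ladderSpan e l) {Ψ : W}
    (hΨ : Ψ ∈ ladderSpan e κ) : T Ψ ∈ ladderSpan e l := by
  have : ladderSpan e κ ≤ (ladderSpan e l).comap T := by
    rw [ladderSpan, Submodule.span_le]
    rintro _ ⟨p, q, hc, rfl⟩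
    exact h p q hc
  exact this hΨ

lemma rotate_to_single (h : IsLadder e x dx y dy) {U : Submodule ℂ W}
    (hU : ∀ α β, ∀ u ∈ U, x α (dx β u) ∈ U) (q : Occ) (k : ℕ) :
    ∀ p : Occ, p 1 = k → e p q ∈ U → e (Pi.single 0 (tot p)) q ∈ U := by
  induction k with
  | zero =>
    intro p hp he
    convert he using 1
    congr 1
    funext α
    fin_cases α
    · simp [tot, hp]
    · simp [hp]
  | succ k ih =>
    intro p hp he
    obtain ⟨m, rfl⟩ := exists_add_single (n := p) (α := 1) (by omega)
    have h1 := hU 0 1 _ he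
    rw [h.dx_apply, map_smul, h.x_apply, add_single_sub_single] at h1
    have h2 := (U.smul_mem_iff (by simp; exact_mod_cast Nat.succ_ne_zero (m 1))).1 h1
    have h3 := ih (m + Pi.single 0 1) (by simpa using hp) h2
    simpa using h3

lemma rotate_from_single (h : IsLadder e x dx y dy) {U : Submodule ℂ W}
    (hU : ∀ α β, ∀ u ∈ U, x α (dx β u) ∈ U) (q : Occ) (k : ℕ) :
    ∀ p : Occ, p 1 = k → e (Pi.single 0 (tot p)) q ∈ U → e p q ∈ U := by
  induction k with
  | zero =>
    intro p hp he
    convert he using 1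
    congr 1
    funext α
    fin_cases α
    · simp [tot, hp]
    · simp [hp]
  | succ k ih =>
    intro p hp he
    obtain ⟨m, rfl⟩ := exists_add_single (n := p) (α := 1) (by omega)
    have h1 := hU 1 0 _ (ih (m + Pi.single 0 1) (by simpa using hp) (by simpa using he))
    rw [h.dx_apply, map_smul, h.x_apply, add_single_sub_single] at h1
    exact (U.smul_mem_iff (by simp; exact_mod_cast Nat.succ_ne_zero (m 0))).1 h1

lemma rotate (h : IsLadder e x dx y dy) {U : Submodule ℂ W}
    (hU : ∀ α β, ∀ u ∈ U, x α (dx β u) ∈ U) {p p' q : Occ} (hp : tot p = tot p')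
    (he : e p q ∈ U) : e p' q ∈ U :=
  h.rotate_from_single hU q _ p' rfl (hp ▸ h.rotate_to_single hU q _ p rfl he)

lemma lower (h : IsLadder e x dx y dy) {U : Submodule ℂ W}
    (hU : ∀ α β, ∀ u ∈ U, dy α (dx β u) ∈ U) (κ k : ℕ) :
    ∀ p q : Occ, tot q = k → tot p = k + κ → e p q ∈ U → ∃ p', tot p' = κ ∧ e p' 0 ∈ U := by
  induction k with
  | zero =>
    intro p q hq hp he
    rw [tot_eq_zero hq] at he
    exact ⟨p, by omega, he⟩
  | succ k ih =>
    intro p q hq hp he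
    obtain ⟨α, hα⟩ := exists_ne_zero_of_tot_pos (n := p) (by omega)
    obtain ⟨β, hβ⟩ := exists_ne_zero_of_tot_pos (n := q) (by omega)
    have h1 := hU β α _ he
    rw [h.dx_apply, map_smul, h.dy_apply] at h1
    have h2 := (U.smul_mem_iff (by exact_mod_cast hβ)).1
      ((U.smul_mem_iff (by exact_mod_cast hα)).1 h1)
    obtain ⟨p, rfl⟩ := exists_add_single hα
    obtain ⟨q, rfl⟩ := exists_add_single hβ
    rw [add_single_sub_single, add_single_sub_single] at h2
    rw [tot_add_single] at hp hq
    exact ih p q (by omega) (by omega) h2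

lemma raise (h : IsLadder e x dx y dy) {U : Submodule ℂ W}
    (hU : ∀ α β, ∀ u ∈ U, x α (y β u) ∈ U) {κ : ℕ} (h0 : ∀ p, tot p = κ → e p 0 ∈ U) (k : ℕ) :
    ∀ p q : Occ, tot q = k → tot p = k + κ → e p q ∈ U := by
  induction k with
  | zero =>
    intro p q hq hp
    rw [tot_eq_zero hq]
    exact h0 p (by omega)
  | succ k ih =>
    intro p q hq hp
    obtain ⟨α, hα⟩ := exists_ne_zero_of_tot_pos (n := p) (by omega)
    obtain ⟨β, hβ⟩ := exists_ne_zero_of_tot_pos (n := q) (by omega)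
    obtain ⟨p, rfl⟩ := exists_add_single hα
    obtain ⟨q, rfl⟩ := exists_add_single hβ
    rw [tot_add_single] at hp hq
    have h1 := hU α β _ (ih p q (by omega) (by omega))
    rwa [h.y_apply, h.x_apply] at h1

lemma x_dx_apply_self (h : IsLadder e x dx y dy) (α : Fin 2) (p q : Occ) :
    x α (dx α (e p q)) = (p α : ℂ) • e p q := by
  rw [h.dx_apply, map_smul, h.x_apply]
  by_cases hp : p α = 0
  · simp [hp]
  · obtain ⟨m, rfl⟩ := exists_add_single hp
    rw [add_single_sub_single]

lemma dy_y_apply_self (h : IsLadder e x dx y dy) (α : Fin 2) (p q : Occ) :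
    dy α (y α (e p q)) = ((q α : ℂ) + 1) • e p q := by
  rw [h.y_apply, h.dy_apply, add_single_sub_single]
  simp

/-- The span of the ladder vectors of chiral parameter `κ` has no proper non-zero subspaces which
are stable under all the bilinear ladder operators. -/
lemma eq_bot_or_eq_ladderSpan (h : IsLadder e x dx y dy) {κ : ℕ} {U : Submodule ℂ W}
    (hle : U ≤ ladderSpan e κ) (hxd : ∀ α β, ∀ u ∈ U, x α (dx β u) ∈ U)
    (hxy : ∀ α β, ∀ u ∈ U, x α (y β u) ∈ U) (hdd : ∀ α β, ∀ u ∈ U, dy α (dx β u) ∈ U)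
    (hdy : ∀ α β, ∀ u ∈ U, dy α (y β u) ∈ U) : U = ⊥ ∨ U = ladderSpan e κ := by
  refine or_iff_not_imp_left.2 fun hbot => le_antisymm hle ?_
  let T : Fin 2 ⊕ Fin 2 → Module.End ℂ W := Sum.elim (fun α => x α * dx α) fun α => dy α * y α
  let c : Fin 2 ⊕ Fin 2 → Occ × Occ → ℂ :=
    Sum.elim (fun α r => r.1 α) fun α r => r.2 α + 1
  obtain ⟨⟨p, q⟩, hpq, he⟩ := exists_eigenvector_mem (e := fun r : Occ × Occ => e r.1 r.2) (T := T)
    (c := c) (S := {r | chirality r.1 r.2 = κ}) (U := U)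
    (by
      rintro (α | α) ⟨p, q⟩
      · exact h.x_dx_apply_self α p q
      · exact h.dy_y_apply_self α p q)
    (by
      rintro ⟨p, q⟩ - ⟨p', q'⟩ - hne
      by_contra! heq
      refine hne (Prod.ext (funext fun α => ?_) (funext fun α => ?_))
      · have := heq (Sum.inl α)
        simpa [c] using this
      · have := heq (Sum.inr α)
        simpa [c] using this)
    (by
      rintro (α | α) u hu
      · exact hxd α α u hu
      · exact hdy α α u hu)
    (by
      refine hle.trans (Submodule.span_mono ?_)
      rintro _ ⟨p, q, hc, rfl⟩
      exact ⟨(p, q), hc, rfl⟩)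
    hbot
  have hpq' : chirality p q = κ := hpq
  rw [chirality_eq] at hpq'
  obtain ⟨p', hp', he'⟩ := h.lower hdd κ (tot q) p q rfl (by omega) he
  have h0 : ∀ p, tot p = κ → e p 0 ∈ U := fun p hp => h.rotate hxd (hp'.trans hp.symm) he'
  rw [ladderSpan, Submodule.span_le]
  rintro _ ⟨n, m, hnm, rfl⟩
  rw [chirality_eq] at hnm
  exact h.raise hxy h0 (tot m) n m rfl (by omega)

/-- The span of the ladder vectors `e p 0` with `p₁ + p₂ = κ` has no proper non-zero subspaces
which are stable under the operators `x_α dx_β`. -/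
lemma eq_bot_or_eq_span_lowest (h : IsLadder e x dx y dy) {κ : ℕ} {U : Submodule ℂ W}
    (hle : U ≤ Submodule.span ℂ {Ψ | ∃ p, tot p = κ ∧ Ψ = e p 0})
    (hxd : ∀ α β, ∀ u ∈ U, x α (dx β u) ∈ U) :
    U = ⊥ ∨ U = Submodule.span ℂ {Ψ | ∃ p, tot p = κ ∧ Ψ = e p 0} := by
  refine or_iff_not_imp_left.2 fun hbot => le_antisymm hle ?_
  obtain ⟨p, hp, he⟩ := exists_eigenvector_mem (e := fun p : Occ => e p 0)
    (T := fun α => x α * dx α) (c := fun α p => p α) (S := {p | tot p = κ}) (U := U)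
    (fun α p => h.x_dx_apply_self α p 0)
    (by
      intro p _ p' _ hne
      by_contra! heq
      exact hne (funext fun α => by exact_mod_cast heq α))
    (fun α u hu => hxd α α u hu)
    (by
      refine hle.trans (Submodule.span_mono ?_)
      rintro _ ⟨p, hp, rfl⟩
      exact ⟨p, hp, rfl⟩)
    hbot
  rw [Submodule.span_le]
  rintro _ ⟨p', hp', rfl⟩
  exact h.rotate hxd (Eq.trans hp hp'.symm) he

lemma x_mem (h : IsLadder e x dx y dy) {κ : ℤ} {Ψ : W} (hΨ : Ψ ∈ ladderSpan e κ) (α : Fin 2) :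
    x α Ψ ∈ ladderSpan e (κ + 1) :=
  map_ladderSpan (fun p q hc => by
    rw [h.x_apply]
    refine mem_ladderSpan ?_
    rw [chirality_eq] at *
    rw [tot_add_single]
    push_cast
    omega) hΨ

lemma y_mem (h : IsLadder e x dx y dy) {κ : ℤ} {Ψ : W} (hΨ : Ψ ∈ ladderSpan e κ) (α : Fin 2) :
    y α Ψ ∈ ladderSpan e (κ - 1) :=
  map_ladderSpan (fun p q hc => by
    rw [h.y_apply]
    refine mem_ladderSpan ?_
    rw [chirality_eq] at *
    rw [tot_add_single]
    push_cast
    omega) hΨ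

lemma dx_mem (h : IsLadder e x dx y dy) {κ : ℤ} {Ψ : W} (hΨ : Ψ ∈ ladderSpan e κ) (α : Fin 2) :
    dx α Ψ ∈ ladderSpan e (κ - 1) :=
  map_ladderSpan (fun p q hc => by
    rw [h.dx_apply]
    by_cases hp : p α = 0
    · simp [hp]
    · obtain ⟨m, rfl⟩ := exists_add_single hp
      rw [add_single_sub_single]
      refine Submodule.smul_mem _ _ (mem_ladderSpan ?_)
      rw [chirality_eq] at *
      rw [tot_add_single] at hc
      push_cast at hc
      omega) hΨ

lemma dy_mem (h : IsLadder e x dx y dy) {κ : ℤ} {Ψ : W} (hΨ : Ψ ∈ ladderSpan e κ) (α : Fin 2) :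
    dy α Ψ ∈ ladderSpan e (κ + 1) :=
  map_ladderSpan (fun p q hc => by
    rw [h.dy_apply]
    by_cases hq : q α = 0
    · simp [hq]
    · obtain ⟨m, rfl⟩ := exists_add_single hq
      rw [add_single_sub_single]
      refine Submodule.smul_mem _ _ (mem_ladderSpan ?_)
      rw [chirality_eq] at *
      rw [tot_add_single] at hc
      push_cast at hc
      omega) hΨ

end IsLadder

/-! ### The two ladder systems of fuzzy functions -/

/-- The rank one operator `(a†)ᵖ|0⟩⟨0|a^q`. -/
def rankOne (p q : Occ) : Fuzzy := (mbra q).smulRight (mket p)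

lemma rankOne_apply (p q : Occ) (v : Fock) : rankOne p q v = mbra q v • mket p := rfl

lemma isLadder_rankOne : IsLadder rankOne (fun α => LinearMap.mulLeft ℂ (cre α))
    (fun α => LinearMap.mulLeft ℂ (ann α)) (fun α => LinearMap.mulRight ℂ (ann α))
    (fun α => LinearMap.mulRight ℂ (cre α)) where
  x_apply α p q := LinearMap.ext fun v => by
    simp [rankOne_apply, cre_mket]
  dx_apply α p q := LinearMap.ext fun v => by
    simp only [LinearMap.mulLeft_apply, Module.End.mul_apply, rankOne_apply, map_smul, ann_mket,
      LinearMap.smul_apply]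
    rw [smul_comm]
  y_apply α p q := LinearMap.ext fun v => by
    simp [rankOne_apply, ← mbra_comp_ann]
  dy_apply α p q := LinearMap.ext fun v => by
    have h := LinearMap.congr_fun (mbra_comp_cre α q) v
    simp only [LinearMap.comp_apply, LinearMap.smul_apply] at h
    simp only [LinearMap.mulRight_apply, Module.End.mul_apply, rankOne_apply,
      LinearMap.smul_apply, h, smul_assoc]

lemma ann_mul_cre_pow (α : Fin 2) (k : ℕ) :
    ann α * cre α ^ k = cre α ^ k * ann α + (k : ℂ) • cre α ^ (k - 1) := by
  induction k with
  | zero => simp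
  | succ k ih =>
    rw [pow_succ, ← mul_assoc, ih, add_mul, mul_assoc, ann_mul_cre_self, mul_add, mul_one,
      smul_mul_assoc, mul_assoc]
    rcases k with _ | k
    · simp
    · rw [Nat.add_sub_cancel, Nat.add_sub_cancel, ← pow_succ]
      push_cast
      module

lemma ann_pow_mul_cre (α : Fin 2) (k : ℕ) :
    ann α ^ k * cre α = cre α * ann α ^ k + (k : ℂ) • ann α ^ (k - 1) := by
  induction k with
  | zero => simp
  | succ k ih =>
    rw [pow_succ', mul_assoc, ih, mul_add, ← mul_assoc, ann_mul_cre_self, add_mul, one_mul,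
      mul_smul_comm, mul_assoc]
    rcases k with _ | k
    · simp
    · simp only [Nat.add_sub_cancel, ← pow_succ']
      push_cast
      module

lemma monomial_eq_mul (n m : Occ) : monomial n m =
    cre 1 ^ n 1 * cre 0 ^ n 0 * ann 1 ^ m 1 * ann 0 ^ m 0 := by
  have h1 : Commute (cre 0) (cre 1) := cre_mul_comm 0 1
  have h2 : Commute (ann 0) (ann 1) := ann_mul_comm 0 1
  rw [monomial, (h1.pow_pow _ _).eq, mul_assoc, (h2.pow_pow _ _).eq, mul_assoc, mul_assoc,
    mul_assoc]

lemma ann_mul_monomial (α : Fin 2) (n m : Occ) : ann α * monomial n m =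
    monomial n m * ann α + (n α : ℂ) • monomial (n - Pi.single α 1) m := by
  have h2 : ∀ β, Commute (ann α) (ann β) := ann_mul_comm α
  fin_cases α
  · have h1 : Commute (ann 0) (cre 1) := ann_mul_cre_of_ne (by decide)
    simp only [monomial, Fin.zero_eta, Fin.isValue, Pi.sub_apply, Pi.single_eq_same,
      Pi.single_eq_of_ne (show (1 : Fin 2) ≠ 0 by decide), Nat.sub_zero] at h2 ⊢
    rw [← mul_assoc, ← mul_assoc, ← mul_assoc, ann_mul_cre_pow]
    simp only [add_mul, mul_assoc, smul_mul_assoc]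
    rw [← ((h2 1).pow_right _).eq, ← mul_assoc (ann 0) (cre 1 ^ _), (h1.pow_right _).eq, mul_assoc,
      ← mul_assoc (ann 0) (ann 0 ^ _), ((h2 0).pow_right _).eq, mul_assoc]
  · have h1 : Commute (ann 1) (cre 0) := ann_mul_cre_of_ne (by decide)
    simp only [monomial_eq_mul, Fin.mk_one, Fin.isValue, Pi.sub_apply, Pi.single_eq_same,
      Pi.single_eq_of_ne (show (0 : Fin 2) ≠ 1 by decide), Nat.sub_zero] at h2 ⊢
    rw [← mul_assoc, ← mul_assoc, ← mul_assoc, ann_mul_cre_pow]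
    simp only [add_mul, mul_assoc, smul_mul_assoc]
    rw [← ((h2 0).pow_right _).eq, ← mul_assoc (ann 1) (cre 0 ^ _), (h1.pow_right _).eq, mul_assoc,
      ← mul_assoc (ann 1) (ann 1 ^ _), ((h2 1).pow_right _).eq, mul_assoc]

lemma monomial_mul_cre (α : Fin 2) (n m : Occ) : monomial n m * cre α =
    cre α * monomial n m + (m α : ℂ) • monomial n (m - Pi.single α 1) := by
  have h2 : ∀ β, Commute (cre α) (cre β) := cre_mul_comm α
  fin_cases α
  · have h1 : Commute (ann 1) (cre 0) := ann_mul_cre_of_ne (by decide)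
    simp only [monomial_eq_mul, Fin.zero_eta, Fin.isValue, Pi.sub_apply, Pi.single_eq_same,
      Pi.single_eq_of_ne (show (1 : Fin 2) ≠ 0 by decide), Nat.sub_zero] at h2 ⊢
    rw [mul_assoc, ann_pow_mul_cre, mul_add, mul_smul_comm, ← mul_assoc, mul_assoc _ _ (cre 0),
      (h1.pow_left _).eq]
    congr 1
    simp only [← mul_assoc]
    rw [((h2 1).pow_right _).eq, mul_assoc (cre 1 ^ _) (cre 0), ((h2 0).pow_right _).eq, mul_assoc]
    simp only [mul_assoc]
  · have h1 : Commute (ann 0) (cre 1) := ann_mul_cre_of_ne (by decide)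
    simp only [monomial, Fin.mk_one, Fin.isValue, Pi.sub_apply, Pi.single_eq_same,
      Pi.single_eq_of_ne (show (0 : Fin 2) ≠ 1 by decide), Nat.sub_zero] at h2 ⊢
    rw [mul_assoc, ann_pow_mul_cre, mul_add, mul_smul_comm, ← mul_assoc, mul_assoc _ _ (cre 1),
      (h1.pow_left _).eq]
    congr 1
    simp only [← mul_assoc]
    rw [((h2 0).pow_right _).eq, mul_assoc (cre 0 ^ _) (cre 1), ((h2 1).pow_right _).eq, mul_assoc]
    simp only [mul_assoc]

lemma cre_mul_monomial (α : Fin 2) (n m : Occ) :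
    cre α * monomial n m = monomial (n + Pi.single α 1) m := by
  fin_cases α
  · simp [monomial, pow_succ', mul_assoc]
  · simp [monomial_eq_mul, pow_succ', mul_assoc]

lemma monomial_mul_ann (α : Fin 2) (n m : Occ) :
    monomial n m * ann α = monomial n (m + Pi.single α 1) := by
  fin_cases α
  · simp [monomial_eq_mul, pow_succ, mul_assoc]
  · simp [monomial, pow_succ, mul_assoc]

lemma isLadder_monomial : IsLadder monomial (fun α => LinearMap.mulLeft ℂ (cre α))
    (fun α => LinearMap.mulLeft ℂ (ann α) - LinearMap.mulRight ℂ (ann α))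
    (fun α => LinearMap.mulRight ℂ (ann α)) adCre where
  x_apply := cre_mul_monomial
  dx_apply α n m := by
    simp only [LinearMap.sub_apply, LinearMap.mulLeft_apply, LinearMap.mulRight_apply]
    rw [ann_mul_monomial, add_sub_cancel_left]
  y_apply := monomial_mul_ann
  dy_apply α n m := by
    simp only [adCre, LinearMap.sub_apply, LinearMap.mulLeft_apply, LinearMap.mulRight_apply]
    rw [monomial_mul_cre, add_sub_cancel_left]

lemma rankOne_ne_zero (p q : Occ) : rankOne p q ≠ 0 := by
  intro h
  have h1 := congrArg (mbra p) (LinearMap.congr_fun h (mket q))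
  rw [rankOne_apply, map_smul, mbra_mket, mbra_mket, if_pos rfl, if_pos rfl,
    LinearMap.zero_apply, map_zero, smul_eq_mul, mul_eq_zero] at h1
  have := occFact_pos p
  have := occFact_pos q
  norm_cast at h1
  omega

lemma monomial_ne_zero (n m : Occ) : monomial n m ≠ 0 := by
  intro h
  have h1 := congrArg (mbra n) (LinearMap.congr_fun h (mket m))
  rw [monomial_mket, tsub_self, zero_add, map_smul, mbra_mket, if_pos rfl,
    LinearMap.zero_apply, map_zero, smul_eq_mul, mul_eq_zero, Nat.descFactorial_self,
    Nat.descFactorial_self] at h1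
  have := occFact_pos n
  have := Nat.factorial_pos (m 0)
  have := Nat.factorial_pos (m 1)
  have : 0 < (m 0).factorial * (m 1).factorial := by positivity
  norm_cast at h1
  omega

lemma rankOne_mem_grade (p q : Occ) : rankOne p q ∈ grade (chirality p q) := by
  refine mem_grade_of_forall_mket fun n => ?_
  rw [rankOne_apply, mbra_mket]
  split_ifs with h
  · refine Submodule.smul_mem _ _ ?_
    subst h
    convert mket_mem_weightSpace p using 2
    rw [chirality_eq]
    push_cast
    ring
  · rw [zero_smul]
    exact Submodule.zero_mem _

lemma rankOne_mul_numOp (p q : Occ) : rankOne p q * numOp = (tot q : ℂ) • rankOne p q :=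
  LinearMap.ext fun v => by
    have h := LinearMap.congr_fun (mbra_comp_numOp q) v
    rw [LinearMap.comp_apply] at h
    rw [Module.End.mul_apply, LinearMap.smul_apply, rankOne_apply, rankOne_apply, h,
      LinearMap.smul_apply, smul_assoc]

/-- A fuzzy function of chiral parameter `κ` whose kernel contains all states with occupation
number other than `k` is a finite combination of rank one operators. -/
lemma mem_span_rankOne {κ : ℂ} {k : ℕ} {Ψ : Fuzzy} (hΨ : Ψ ∈ grade κ)
    (hk : Ψ * numOp = (k : ℂ) • Ψ) :
    Ψ ∈ Submodule.span ℂ {Φ | ∃ p q, tot q = k ∧ (tot p : ℂ) = k + κ ∧ Φ = rankOne p q} := by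
  have hz : ∀ q, tot q ≠ k → Ψ (mket q) = 0 := by
    intro q hq
    have h := LinearMap.congr_fun hk (mket q)
    rw [Module.End.mul_apply, numOp_mket, map_smul, LinearMap.smul_apply, ← sub_eq_zero,
      ← sub_smul, smul_eq_zero, sub_eq_zero] at h
    exact h.resolve_left (by exact_mod_cast hq)
  have hsum : Ψ = ∑ q ∈ Finset.Nat.antidiagonalTuple 2 k,
      (occFact q : ℂ)⁻¹ • (mbra q).smulRight (Ψ (mket q)) := by
    refine fock_hom_ext fun n => ?_
    rw [LinearMap.sum_apply]
    simp only [LinearMap.smul_apply, LinearMap.smulRight_apply, mbra_mket]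
    by_cases hn : tot n = k
    · rw [Finset.sum_eq_single n]
      · have : (occFact n : ℂ) ≠ 0 := by exact_mod_cast (occFact_pos n).ne'
        rw [if_pos rfl, smul_smul, inv_mul_cancel₀ this, one_smul]
      · intro q _ hq
        rw [if_neg hq, zero_smul, smul_zero]
      · intro h
        exact absurd (Finset.Nat.mem_antidiagonalTuple.2 (by rw [Fin.sum_univ_two]; exact hn)) h
    · rw [hz n hn]
      refine (Finset.sum_eq_zero fun q _ => ?_).symm
      split_ifs with h
      · rw [h, hz n hn, smul_zero, smul_zero]
      · rw [zero_smul, smul_zero]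
  rw [hsum]
  refine Submodule.sum_mem _ fun q hq => Submodule.smul_mem _ _ ?_
  have hq' : tot q = k := by
    have := Finset.Nat.mem_antidiagonalTuple.1 hq
    rwa [Fin.sum_univ_two] at this
  have hw := apply_mem_weightSpace hΨ (mket_mem_weightSpace q)
  rw [hq'] at hw
  have hexp := sum_mbra_smul_mket (v := Ψ (mket q))
    (S := (finite_mbra_ne_zero (Ψ (mket q))).toFinset) (by simp)
  rw [← hexp]
  have hmap : (mbra q).smulRight (∑ p ∈ (finite_mbra_ne_zero (Ψ (mket q))).toFinset,
      ((occFact p : ℂ)⁻¹ * mbra p (Ψ (mket q))) • mket p) =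
      ∑ p ∈ (finite_mbra_ne_zero (Ψ (mket q))).toFinset,
      ((occFact p : ℂ)⁻¹ * mbra p (Ψ (mket q))) • rankOne p q := by
    refine LinearMap.ext fun v => ?_
    rw [LinearMap.sum_apply, LinearMap.smulRight_apply, Finset.smul_sum]
    exact Finset.sum_congr rfl fun p _ => by
      rw [LinearMap.smul_apply, rankOne_apply, smul_comm]
  rw [hmap]
  refine Submodule.sum_mem _ fun p hp => Submodule.smul_mem _ _ (Submodule.subset_span ?_)
  refine ⟨p, q, hq', ?_, rfl⟩
  by_contra h
  exact (by simpa using hp : mbra p (Ψ (mket q)) ≠ 0) (mbra_eq_zero_of_mem_weightSpace hw h)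

/-! ### The oscillator representation -/

lemma oscA_mul_comm (i j : Fin 2 ⊕ Fin 2) : oscA i * oscA j = oscA j * oscA i := by
  refine LinearMap.ext fun Ψ => ?_
  rcases i with α | α <;> rcases j with β | β <;>
    simp only [oscA, Sum.elim_inl, Sum.elim_inr, Module.End.mul_apply, LinearMap.mulLeft_apply,
      LinearMap.mulRight_apply, mul_assoc]
  · rw [← mul_assoc, ann_mul_comm, mul_assoc]
  · rw [ann_mul_comm]

lemma oscAdag_mul_comm (i j : Fin 2 ⊕ Fin 2) : oscAdag i * oscAdag j = oscAdag j * oscAdag i := by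
  refine LinearMap.ext fun Ψ => ?_
  rcases i with α | α <;> rcases j with β | β <;>
    simp only [oscAdag, Sum.elim_inl, Sum.elim_inr, Module.End.mul_apply, LinearMap.mulLeft_apply,
      LinearMap.mulRight_apply, mul_assoc]
  · rw [← mul_assoc, cre_mul_comm, mul_assoc]
  · rw [cre_mul_comm]

lemma oscA_mul_oscAdag (i j : Fin 2 ⊕ Fin 2) :
    oscA i * oscAdag j = oscAdag j * oscA i + Gam i j • 1 := by
  refine LinearMap.ext fun Ψ => ?_
  rcases i with α | α <;> rcases j with β | β <;>
    simp only [oscA, oscAdag, Sum.elim_inl, Sum.elim_inr, Module.End.mul_apply,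
      LinearMap.mulLeft_apply, LinearMap.mulRight_apply, mul_assoc, LinearMap.add_apply,
      LinearMap.smul_apply, Module.End.one_apply, Gam, Matrix.fromBlocks_apply₁₁,
      Matrix.fromBlocks_apply₁₂, Matrix.fromBlocks_apply₂₁, Matrix.fromBlocks_apply₂₂,
      Matrix.zero_apply, zero_smul, add_zero]
  · rw [← mul_assoc, ann_mul_cre, add_mul, mul_assoc, smul_mul_assoc, one_mul, Matrix.one_apply]
  · rw [ann_mul_cre, mul_add, mul_smul_comm, mul_one, Matrix.neg_apply, Matrix.one_apply, neg_smul,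
      add_neg_cancel_right]

lemma fundRep_add (X Y : Mat) : fundRep (X + Y) = fundRep X + fundRep Y := by
  simp only [fundRep, mul_add, Matrix.add_apply, add_smul, Finset.sum_add_distrib]

lemma fundRep_smul (c : ℂ) (X : Mat) : fundRep (c • X) = c • fundRep X := by
  simp only [fundRep, mul_smul_comm, Matrix.smul_apply, smul_eq_mul, mul_smul, Finset.smul_sum]

lemma fundRep_neg (X : Mat) : fundRep (-X) = -fundRep X := by
  rw [← neg_one_smul ℂ X, fundRep_smul, neg_one_smul ℂ (fundRep X)]

lemma Gam_mul_Gam : Gam * Gam = 1 := by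
  simp [Gam, Matrix.fromBlocks_multiply]

lemma Gam_conjTranspose : Gam.conjTranspose = Gam := by
  simp [Gam, Matrix.fromBlocks_conjTranspose]

lemma Gam_transpose : Gam.transpose = Gam := by
  simp [Gam, Matrix.fromBlocks_transpose]

lemma bilinear_commutator (i j k l : Fin 2 ⊕ Fin 2) :
    (oscAdag i * oscA j) * (oscAdag k * oscA l) - (oscAdag k * oscA l) * (oscAdag i * oscA j) =
      Gam j k • (oscAdag i * oscA l) - Gam l i • (oscAdag k * oscA j) := by
  have h1 : (oscAdag i * oscA j) * (oscAdag k * oscA l) =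
      oscAdag i * oscAdag k * (oscA j * oscA l) + Gam j k • (oscAdag i * oscA l) := by
    rw [mul_assoc, ← mul_assoc (oscA j), oscA_mul_oscAdag, add_mul, mul_add, smul_mul_assoc,
      one_mul, mul_smul_comm]
    simp only [mul_assoc]
  have h2 : (oscAdag k * oscA l) * (oscAdag i * oscA j) =
      oscAdag i * oscAdag k * (oscA j * oscA l) + Gam l i • (oscAdag k * oscA j) := by
    rw [mul_assoc, ← mul_assoc (oscA l), oscA_mul_oscAdag, add_mul, mul_add, smul_mul_assoc,
      one_mul, mul_smul_comm, oscAdag_mul_comm i k, oscA_mul_comm j l]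
    simp only [mul_assoc]
  rw [h1, h2]
  abel

lemma sum_reverse {ι M : Type*} [Fintype ι] [AddCommMonoid M] (f : ι → ι → ι → M) :
    ∑ a, ∑ b, ∑ c, f a b c = ∑ c, ∑ b, ∑ a, f a b c := by
  rw [Finset.sum_comm, Finset.sum_congr rfl fun b _ => Finset.sum_comm]
  exact Finset.sum_comm

lemma fundRep_commutator (X Y : Mat) :
    fundRep X * fundRep Y - fundRep Y * fundRep X = fundRep (X * Y - Y * X) := by
  have key : ∀ M N : Mat,
      (∑ i, ∑ j, M i j • (oscAdag i * oscA j)) * (∑ k, ∑ l, N k l • (oscAdag k * oscA l)) -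
        (∑ k, ∑ l, N k l • (oscAdag k * oscA l)) * (∑ i, ∑ j, M i j • (oscAdag i * oscA j)) =
      ∑ i, ∑ j, (M * Gam * N - N * Gam * M) i j • (oscAdag i * oscA j) := by
    intro M N
    have e1 : (∑ i, ∑ j, M i j • (oscAdag i * oscA j)) * (∑ k, ∑ l, N k l • (oscAdag k * oscA l)) =
        ∑ i, ∑ j, ∑ k, ∑ l, (M i j * N k l) • ((oscAdag i * oscA j) * (oscAdag k * oscA l)) := by
      simp only [Finset.sum_mul]
      simp only [Finset.mul_sum, smul_mul_smul_comm]
    have e2 : (∑ k, ∑ l, N k l • (oscAdag k * oscA l)) * (∑ i, ∑ j, M i j • (oscAdag i * oscA j)) =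
        ∑ i, ∑ j, ∑ k, ∑ l, (M i j * N k l) • ((oscAdag k * oscA l) * (oscAdag i * oscA j)) := by
      simp only [Finset.mul_sum]
      simp only [Finset.sum_mul, smul_mul_smul_comm]
      refine Finset.sum_congr rfl fun i _ => Finset.sum_congr rfl fun j _ =>
        Finset.sum_congr rfl fun k _ => Finset.sum_congr rfl fun l _ => by rw [mul_comm (N k l)]
    have e3 : ∑ i, ∑ l, (M * Gam * N) i l • (oscAdag i * oscA l) =
        ∑ i, ∑ j, ∑ k, ∑ l, (M i j * N k l) • Gam j k • (oscAdag i * oscA l) := by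
      refine Finset.sum_congr rfl fun i _ => ?_
      rw [sum_reverse]
      simp only [Matrix.mul_apply, Finset.sum_mul, Finset.sum_smul, smul_smul]
      refine Finset.sum_congr rfl fun j _ => Finset.sum_congr rfl fun k _ =>
        Finset.sum_congr rfl fun l _ => by rw [mul_right_comm]
    have e4 : ∑ k, ∑ j, (N * Gam * M) k j • (oscAdag k * oscA j) =
        ∑ i, ∑ j, ∑ k, ∑ l, (M i j * N k l) • Gam l i • (oscAdag k * oscA j) := by
      rw [sum_reverse]
      simp only [Matrix.mul_apply, Finset.sum_mul, Finset.sum_smul, smul_smul]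
      refine Finset.sum_congr rfl fun k _ => Finset.sum_congr rfl fun j _ =>
        Finset.sum_congr rfl fun i _ => Finset.sum_congr rfl fun l _ => ?_
      congr 1
      ring
    have e5 : ∀ i j, (M * Gam * N - N * Gam * M) i j • (oscAdag i * oscA j) =
        (M * Gam * N) i j • (oscAdag i * oscA j) - (N * Gam * M) i j • (oscAdag i * oscA j) :=
      fun i j => sub_smul _ _ (oscAdag i * oscA j)
    simp only [e5, Finset.sum_sub_distrib]
    rw [e1, e2, e3, e4]
    simp only [← Finset.sum_sub_distrib]
    exact Finset.sum_congr rfl fun i _ => Finset.sum_congr rfl fun j _ =>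
      Finset.sum_congr rfl fun k _ => Finset.sum_congr rfl fun l _ =>
        (smul_sub (M i j * N k l) _ _).symm.trans
          ((congrArg ((M i j * N k l) • ·) (bilinear_commutator i j k l)).trans (smul_sub _ _ _))
  rw [fundRep, fundRep, key, fundRep]
  have : Gam * X * Gam * (Gam * Y) - Gam * Y * Gam * (Gam * X) = Gam * (X * Y - Y * X) := by
    rw [mul_assoc (Gam * X), ← mul_assoc Gam Gam, Gam_mul_Gam, one_mul, mul_assoc (Gam * Y),
      ← mul_assoc Gam Gam, Gam_mul_Gam, one_mul, mul_sub, mul_assoc, mul_assoc]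
  rw [this]

lemma oscA_mem_grade {κ : ℂ} {Ψ : Fuzzy} (hΨ : Ψ ∈ grade κ) (i : Fin 2 ⊕ Fin 2) :
    oscA i Ψ ∈ grade (κ - 1) := by
  rcases i with α | α
  · rw [sub_eq_add_neg, add_comm]
    exact mul_mem_grade (ann_mem_grade α) hΨ
  · rw [sub_eq_add_neg]
    exact mul_mem_grade hΨ (ann_mem_grade α)

lemma oscAdag_mem_grade {κ : ℂ} {Ψ : Fuzzy} (hΨ : Ψ ∈ grade κ) (i : Fin 2 ⊕ Fin 2) :
    oscAdag i Ψ ∈ grade (κ + 1) := by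
  rcases i with α | α
  · rw [add_comm]
    exact mul_mem_grade (cre_mem_grade α) hΨ
  · exact mul_mem_grade hΨ (cre_mem_grade α)

/-- If all bilinears `Â†_i Â_j` preserve a space, so does the oscillator representation. -/
lemma fundRep_mem {V : Submodule ℂ Fuzzy} {Ψ : Fuzzy}
    (h : ∀ i j, (oscAdag i * oscA j) Ψ ∈ V) (X : Mat) : fundRep X Ψ ∈ V := by
  rw [fundRep, LinearMap.sum_apply]
  refine Submodule.sum_mem _ fun i _ => ?_
  rw [LinearMap.sum_apply]
  exact Submodule.sum_mem _ fun j _ => Submodule.smul_mem _ _ (h i j)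

lemma fundRep_mem_grade {κ : ℂ} {Ψ : Fuzzy} (hΨ : Ψ ∈ grade κ) (X : Mat) :
    fundRep X Ψ ∈ grade κ :=
  fundRep_mem (fun i j => by
    have h := oscAdag_mem_grade (oscA_mem_grade hΨ j) i
    rwa [sub_add_cancel] at h) X

lemma sum_ann_mul_cre : ∑ α, ann α * cre α = numOp + (2 : ℂ) • 1 := by
  rw [numOp, Fin.sum_univ_two, Fin.sum_univ_two, ann_mul_cre_self, ann_mul_cre_self]
  module

lemma sum_inl_apply (Ψ : Fuzzy) :
    ∑ α, (oscAdag (Sum.inl α) * oscA (Sum.inl α)) Ψ = numOp * Ψ := by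
  simp [oscA, oscAdag, numOp, Module.End.mul_apply, add_mul, mul_assoc]

lemma sum_inr_apply (Ψ : Fuzzy) :
    ∑ α, (oscAdag (Sum.inr α) * oscA (Sum.inr α)) Ψ = Ψ * numOp + (2 : ℂ) • Ψ := by
  have h : Ψ * numOp + (2 : ℂ) • Ψ = Ψ * ∑ α, ann α * cre α := by
    rw [sum_ann_mul_cre, mul_add, mul_smul_comm, mul_one]
  rw [h]
  simp [oscA, oscAdag, Module.End.mul_apply, mul_add, mul_assoc]

lemma fundRep_fromBlocks_diag (A B : Matrix (Fin 2) (Fin 2) ℂ) (Ψ : Fuzzy) :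
    fundRep (Matrix.fromBlocks A 0 0 B) Ψ =
      ∑ α, ∑ β, A α β • (oscAdag (Sum.inl α) * oscA (Sum.inl β)) Ψ -
      ∑ α, ∑ β, B α β • (oscAdag (Sum.inr α) * oscA (Sum.inr β)) Ψ := by
  simp only [fundRep, Gam, Matrix.fromBlocks_multiply, Fintype.sum_sum_type, LinearMap.add_apply,
    LinearMap.sum_apply, LinearMap.smul_apply, Matrix.fromBlocks_apply₁₁,
    Matrix.fromBlocks_apply₁₂, Matrix.fromBlocks_apply₂₁, Matrix.fromBlocks_apply₂₂]
  simp only [one_mul, zero_mul, add_zero, zero_add, neg_mul, Matrix.zero_apply,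
    Matrix.neg_apply, neg_zero, zero_smul, Finset.sum_const_zero, neg_smul, Finset.sum_neg_distrib,
    sub_eq_add_neg]

lemma fundRep_fromBlocks_smul_one (a b : ℂ) (Ψ : Fuzzy) :
    fundRep (Matrix.fromBlocks (a • 1) 0 0 (b • 1)) Ψ =
      a • (numOp * Ψ) - b • (Ψ * numOp + (2 : ℂ) • Ψ) := by
  rw [fundRep_fromBlocks_diag, ← sum_inl_apply, ← sum_inr_apply]
  simp only [Matrix.smul_apply, Matrix.one_apply, Fin.sum_univ_two]
  simp

lemma fundRep_one_apply {κ : ℂ} {Ψ : Fuzzy} (hΨ : Ψ ∈ grade κ) :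
    fundRep 1 Ψ = (κ - 2) • Ψ := by
  have h : (1 : Mat) = Matrix.fromBlocks ((1 : ℂ) • 1) 0 0 ((1 : ℂ) • 1) := by
    simp
  rw [h, fundRep_fromBlocks_smul_one, mem_grade.1 hΨ]
  module

/-- `X` is a complex combination of two elements of `su(2,2)` if it is traceless. -/
lemma exists_su22_add_smul {X : Mat} (hX : X.trace = 0) :
    ∃ Y ∈ su22, ∃ Z ∈ su22, X = Y + Complex.I • Z := by
  have hG : Gam * Gam = 1 := Gam_mul_Gam
  have htr : (Gam * X.conjTranspose * Gam).trace = 0 := by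
    rw [Matrix.trace_mul_comm, ← mul_assoc, hG, one_mul, Matrix.trace_conjTranspose, hX, star_zero]
  have hc : (Gam * X.conjTranspose * Gam).conjTranspose = Gam * X * Gam := by
    rw [Matrix.conjTranspose_mul, Matrix.conjTranspose_mul, Gam_conjTranspose,
      Matrix.conjTranspose_conjTranspose, mul_assoc]
  refine ⟨(1 / 2 : ℂ) • (X - Gam * X.conjTranspose * Gam), ⟨?_, ?_⟩,
    (-Complex.I / 2 : ℂ) • (X + Gam * X.conjTranspose * Gam), ⟨?_, ?_⟩, ?_⟩
  · rw [Matrix.conjTranspose_smul, Matrix.conjTranspose_sub, hc]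
    simp only [smul_mul_assoc, mul_smul_comm, sub_mul, mul_sub, ← mul_assoc, hG, one_mul]
    rw [mul_assoc _ Gam Gam, hG, mul_one]
    simp
    module
  · rw [Matrix.trace_smul, Matrix.trace_sub, htr, hX]; simp
  · rw [Matrix.conjTranspose_smul, Matrix.conjTranspose_add, hc]
    simp only [smul_mul_assoc, mul_smul_comm, add_mul, mul_add, ← mul_assoc, hG, one_mul]
    rw [mul_assoc _ Gam Gam, hG, mul_one]
    simp
    module
  · rw [Matrix.trace_smul, Matrix.trace_add, htr, hX]; simp
  · rw [smul_smul]
    have : Complex.I * (-Complex.I / 2) = 1 / 2 := by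
      linear_combination (-1 / 2 : ℂ) * Complex.I_mul_I
    rw [this]
    module

lemma fundRep_mem_of_isInvariant {κ : ℂ} {U : Submodule ℂ Fuzzy} (hU : U ≤ grade κ)
    (hinv : IsInvariant fundRep su22 U) {Ψ : Fuzzy} (hΨ : Ψ ∈ U) (X : Mat) :
    fundRep X Ψ ∈ U := by
  have htr : (X - (X.trace / 4) • (1 : Mat)).trace = 0 := by
    rw [Matrix.trace_sub, Matrix.trace_smul, Matrix.trace_one]
    simp
  obtain ⟨Y, hY, Z, hZ, h⟩ := exists_su22_add_smul htr
  rw [sub_eq_iff_eq_add.1 h, fundRep_add, fundRep_add, fundRep_smul, fundRep_smul,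
    LinearMap.add_apply, LinearMap.add_apply, LinearMap.smul_apply, LinearMap.smul_apply,
    fundRep_one_apply (hU hΨ)]
  exact U.add_mem (U.add_mem (hinv Y hY Ψ hΨ) (U.smul_mem _ (hinv Z hZ Ψ hΨ)))
    (U.smul_mem _ (U.smul_mem _ hΨ))

lemma fundRep_single (i j : Fin 2 ⊕ Fin 2) :
    fundRep (Gam * Matrix.single i j 1) = oscAdag i * oscA j := by
  rw [fundRep, ← mul_assoc, Gam_mul_Gam, one_mul]
  simp [Matrix.single_apply, ite_and, ite_smul]

lemma bilinear_mem_of_isInvariant {κ : ℂ} {U : Submodule ℂ Fuzzy} (hU : U ≤ grade κ)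
    (hinv : IsInvariant fundRep su22 U) (i j : Fin 2 ⊕ Fin 2) {Ψ : Fuzzy} (hΨ : Ψ ∈ U) :
    oscAdag i (oscA j Ψ) ∈ U := by
  rw [← Module.End.mul_apply, ← fundRep_single]
  exact fundRep_mem_of_isInvariant hU hinv hΨ _

/-! ### Bilinear expressions and Fierz identities -/

section Bil

variable {A : Type*} [Ring A] [Algebra ℂ A]

/-- The bilinear expression `u τ v = ∑ τ_{αβ} u_α v_β`. -/
def bil (τ : Matrix (Fin 2) (Fin 2) ℂ) (u v : Fin 2 → A) : A :=
  ∑ α, ∑ β, τ α β • (u α * v β)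

lemma bil_add_left (τ : Matrix (Fin 2) (Fin 2) ℂ) (u u' v : Fin 2 → A) :
    bil τ (u + u') v = bil τ u v + bil τ u' v := by
  simp only [bil, Pi.add_apply, add_mul, smul_add, Finset.sum_add_distrib]

lemma bil_add_right (τ : Matrix (Fin 2) (Fin 2) ℂ) (u v v' : Fin 2 → A) :
    bil τ u (v + v') = bil τ u v + bil τ u v' := by
  simp only [bil, Pi.add_apply, mul_add, smul_add, Finset.sum_add_distrib]

lemma bil_smul_left (τ : Matrix (Fin 2) (Fin 2) ℂ) (c : ℂ) (u v : Fin 2 → A) :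
    bil τ (c • u) v = c • bil τ u v := by
  simp only [bil, Pi.smul_apply, smul_mul_assoc, Finset.smul_sum, smul_comm c]

lemma bil_smul_right (τ : Matrix (Fin 2) (Fin 2) ℂ) (c : ℂ) (u v : Fin 2 → A) :
    bil τ u (c • v) = c • bil τ u v := by
  simp only [bil, Pi.smul_apply, mul_smul_comm, Finset.smul_sum, smul_comm c]

lemma bil_smul (c : ℂ) (τ : Matrix (Fin 2) (Fin 2) ℂ) (u v : Fin 2 → A) :
    bil (c • τ) u v = c • bil τ u v := by
  simp only [bil, Matrix.smul_apply, smul_eq_mul, mul_smul, Finset.smul_sum]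

/-- Two pairs of commuting derivations together with the variables of the second pair. -/
structure IsWeyl (dx y dy : Fin 2 → A) : Prop where
  dx_dx : ∀ α β, dx α * dx β = dx β * dx α
  dy_dy : ∀ α β, dy α * dy β = dy β * dy α
  dx_dy : ∀ α β, dx α * dy β = dy β * dx α
  dy_y : ∀ α β, dy α * y β = y β * dy α + (if α = β then 1 else 0 : ℂ) • 1

end Bil

lemma assoc_of_mul_eq {A : Type*} [Ring A] {a b c d : A} (h : a * b = c * d) (t : A) :
    a * (b * t) = c * (d * t) := by
  rw [← mul_assoc, h, mul_assoc]

lemma assoc_of_mul_eq_add_one {A : Type*} [Ring A] {a b c d : A} (h : a * b = c * d + 1) (t : A) :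
    a * (b * t) = c * (d * t) + t := by
  rw [← mul_assoc, h, add_mul, mul_assoc, one_mul]

/-- The matrices `σ_k` for `s = 1` and their transposes for `s = -1`. -/
def pauliSign (s : ℂ) : Fin 3 → Matrix (Fin 2) (Fin 2) ℂ :=
  ![!![0, 1; 1, 0], !![0, -(s * Complex.I); s * Complex.I, 0], !![1, 0; 0, -1]]

lemma pauliSign_one : pauliSign 1 = pauli := by
  simp [pauliSign, pauli]

lemma pauliSign_neg_one (k : Fin 3) : pauliSign (-1) k = (pauli k).transpose := by
  fin_cases k <;> ext i j <;> fin_cases i <;> fin_cases j <;> simp [pauliSign, pauli]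

namespace IsWeyl

variable {A : Type*} [Ring A] [Algebra ℂ A] {x dx y dy : Fin 2 → A}

/-- The rewriting rules which bring a product into the order `y`, `dy`, `dx`. -/
lemma normalOrder (h : IsWeyl dx y dy) :
    (dx 1 * dx 0 = dx 0 * dx 1 ∧ dy 1 * dy 0 = dy 0 * dy 1 ∧ ∀ α β, dx α * dy β = dy β * dx α) ∧
    ((∀ α, dy α * y α = y α * dy α + 1) ∧ dy 0 * y 1 = y 1 * dy 0 ∧ dy 1 * y 0 = y 0 * dy 1) ∧
    ((∀ t, dx 1 * (dx 0 * t) = dx 0 * (dx 1 * t)) ∧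
      (∀ t, dy 1 * (dy 0 * t) = dy 0 * (dy 1 * t)) ∧
      ∀ α β t, dx α * (dy β * t) = dy β * (dx α * t)) ∧
    ((∀ α t, dy α * (y α * t) = y α * (dy α * t) + t) ∧
      (∀ t, dy 0 * (y 1 * t) = y 1 * (dy 0 * t)) ∧ ∀ t, dy 1 * (y 0 * t) = y 0 * (dy 1 * t)) := by
  have h1 : ∀ α, dy α * y α = y α * dy α + 1 := fun α => by simp [h.dy_y]
  have h2 : dy 0 * y 1 = y 1 * dy 0 := by simp [h.dy_y]
  have h3 : dy 1 * y 0 = y 0 * dy 1 := by simp [h.dy_y]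
  exact ⟨⟨h.dx_dx 1 0, h.dy_dy 1 0, h.dx_dy⟩, ⟨h1, h2, h3⟩,
    ⟨assoc_of_mul_eq (h.dx_dx 1 0), assoc_of_mul_eq (h.dy_dy 1 0),
      fun α β => assoc_of_mul_eq (h.dx_dy α β)⟩,
    ⟨fun α => assoc_of_mul_eq_add_one (h1 α), assoc_of_mul_eq h2, assoc_of_mul_eq h3⟩⟩

lemma fierz_time (h : IsWeyl dx y dy) {s : ℂ} (hs : s = 1 ∨ s = -1) :
    ∑ k, (bil (pauliSign s k) x dx - bil (pauliSign s k) dy y) * bil (pauliSign s k) dy dx =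
      (bil 1 x dx - bil 1 dy y + (2 : ℂ) • 1) * bil 1 dy dx := by
  simp only [bil, pauliSign, Fin.sum_univ_two, Fin.sum_univ_three]
  rcases hs with rfl | rfl <;>
  · simp [add_mul, mul_add, sub_mul, mul_sub, mul_assoc, smul_smul, smul_add, smul_sub,
      h.normalOrder]
    module

lemma fierz_space (h : IsWeyl dx y dy) {s : ℂ} (hs : s = 1 ∨ s = -1) (i : Fin 3) :
    (bil (pauliSign s i) x dx - bil (pauliSign s i) dy y) * bil 1 dy dx +
      (s * Complex.I) • ((bil (pauliSign s (i + 1)) x dx + bil (pauliSign s (i + 1)) dy y) *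
          bil (pauliSign s (i + 2)) dy dx -
        (bil (pauliSign s (i + 2)) x dx + bil (pauliSign s (i + 2)) dy y) *
          bil (pauliSign s (i + 1)) dy dx) =
      (bil 1 x dx - bil 1 dy y + (2 : ℂ) • 1) * bil (pauliSign s i) dy dx := by
  simp only [bil, pauliSign, Fin.sum_univ_two]
  fin_cases i <;> rcases hs with rfl | rfl <;>
  · simp [add_mul, mul_add, sub_mul, mul_sub, mul_assoc, smul_smul, smul_add, smul_sub,
      h.normalOrder]
    module

lemma bil_commute (h : IsWeyl dx y dy) (τ ρ : Matrix (Fin 2) (Fin 2) ℂ) :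
    Commute (bil τ dy dx) (bil ρ dy dx) := by
  have key : ∀ α β, Commute (dx α) (dy β) := h.dx_dy
  refine Commute.sum_left _ _ _ fun α _ => Commute.sum_left _ _ _ fun β _ =>
    Commute.sum_right _ _ _ fun γ _ => Commute.sum_right _ _ _ fun δ _ =>
    Commute.smul_left (Commute.smul_right (Commute.mul_left ?_ ?_) _) _
  · exact Commute.mul_right (h.dy_dy α γ) (key δ α).symm
  · exact Commute.mul_right (key β γ) (h.dx_dx β δ)

lemma fierz_null (h : IsWeyl dx y dy) {s : ℂ} (hs : s = 1 ∨ s = -1) :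
    bil 1 dy dx * bil 1 dy dx =
      ∑ k, bil (pauliSign s k) dy dx * bil (pauliSign s k) dy dx := by
  simp only [bil, pauliSign, Fin.sum_univ_two, Fin.sum_univ_three]
  rcases hs with rfl | rfl <;>
  · simp [add_mul, mul_add, sub_mul, mul_sub, mul_assoc, smul_smul, smul_add, smul_sub,
      h.normalOrder]
    module

end IsWeyl

/-! ### The Levi-Civita symbol and the Pauli–Lubanski vector -/

lemma levi_mul (μ ν ρ σ : Fin 4) : levi μ ν ρ σ * 12 =
    ((((ν : ℕ) - (μ : ℕ)) * ((ρ : ℕ) - (μ : ℕ)) * ((σ : ℕ) - (μ : ℕ)) * ((ρ : ℕ) - (ν : ℕ)) *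
      ((σ : ℕ) - (ν : ℕ)) * ((σ : ℕ) - (ρ : ℕ)) : ℤ) : ℂ) := by
  have h12 : (Matrix.vandermonde fun i : Fin 4 => ((i : ℕ) : ℂ)).det = 12 := by
    rw [Matrix.det_vandermonde]
    simp [Fin.prod_univ_succ, Fin.prod_Ioi_succ, Fin.prod_Ioi_zero]
    norm_num
  have hv : (Matrix.of fun i j : Fin 4 => if ![μ, ν, ρ, σ] i = j then (1 : ℂ) else 0) *
      (Matrix.vandermonde fun i : Fin 4 => ((i : ℕ) : ℂ)) =
      Matrix.vandermonde fun i => ((![μ, ν, ρ, σ] i : ℕ) : ℂ) := by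
    ext i j
    simp [Matrix.mul_apply, Matrix.vandermonde_apply]
  rw [levi, ← h12, ← Matrix.det_mul, hv, Matrix.det_vandermonde]
  simp [Fin.prod_univ_succ, Fin.prod_Ioi_succ, Fin.prod_Ioi_zero]
  ring

lemma levi_eq (μ ν ρ σ : Fin 4) : levi μ ν ρ σ =
    ((((ν : ℕ) - (μ : ℕ)) * ((ρ : ℕ) - (μ : ℕ)) * ((σ : ℕ) - (μ : ℕ)) * ((ρ : ℕ) - (ν : ℕ)) *
      ((σ : ℕ) - (ν : ℕ)) * ((σ : ℕ) - (ρ : ℕ)) : ℤ) : ℂ) / 12 := by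
  rw [← levi_mul]
  ring

lemma levi_contract_time {A : Type*} [Ring A] [Algebra ℂ A] {S : Fin 4 → Fin 4 → A} {P : Fin 4 → A}
    (hS : ∀ μ ν, S μ ν = -S ν μ) :
    (1 / 2 : ℂ) • ∑ ν, ∑ ρ, ∑ σ, (levi 0 ν ρ σ * eta ν * eta ρ * eta σ) • (S ν ρ * P σ) =
      -(S 2 3 * P 1 + S 3 1 * P 2 + S 1 2 * P 3) := by
  have h1 := hS 3 2
  have h2 := hS 1 3
  have h3 := hS 2 1
  simp only [Fin.sum_univ_four, levi_eq, eta]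
  simp [h1, h2, h3]
  norm_num
  module

/-- The spatial components, for cyclic `(i, i + 1, i + 2)`. -/
lemma levi_contract_space {A : Type*} [Ring A] [Algebra ℂ A] {S : Fin 4 → Fin 4 → A}
    {P : Fin 4 → A} (hS : ∀ μ ν, S μ ν = -S ν μ) (i : Fin 3) :
    (1 / 2 : ℂ) • ∑ ν, ∑ ρ, ∑ σ, (levi i.succ ν ρ σ * eta ν * eta ρ * eta σ) • (S ν ρ * P σ) =
      S 0 (i + 2).succ * P (i + 1).succ - S 0 (i + 1).succ * P (i + 2).succ -
        S (i + 1).succ (i + 2).succ * P 0 := by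
  have h1 := hS 3 2
  have h2 := hS 1 3
  have h3 := hS 2 1
  have h4 := hS 1 0
  have h5 := hS 2 0
  have h6 := hS 3 0
  fin_cases i <;>
  · simp only [Fin.sum_univ_four, levi_eq, eta]
    simp [h1, h2, h3, h4, h5, h6]
    norm_num
    module

/-- Generators of the Poincaré algebra as bilinears in the variables and derivations. -/
structure IsPoincare {A : Type*} [Ring A] [Algebra ℂ A] (x dx y dy : Fin 2 → A) (s : ℂ)
    (S : Fin 4 → Fin 4 → A) (P : Fin 4 → A) : Prop where
  antisymm : ∀ μ ν, S μ ν = -S ν μ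
  momentum_time : P 0 = (Complex.I / 2) • bil 1 dy dx
  momentum_space : ∀ i : Fin 3, P i.succ = (Complex.I / 2) • bil (pauliSign s i) dy dx
  boost : ∀ i : Fin 3, S 0 i.succ = (-(1 / 2) : ℂ) • (bil (pauliSign s i) x dx +
    bil (pauliSign s i) dy y + s • bil (pauliSign s i) dy dx)
  rotation : ∀ i : Fin 3, S (i + 1).succ (i + 2).succ =
    (s * Complex.I / 2) • (bil (pauliSign s i) x dx - bil (pauliSign s i) dy y)

namespace IsPoincare

variable {A : Type*} [Ring A] [Algebra ℂ A] {x dx y dy : Fin 2 → A} {s : ℂ}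
  {S : Fin 4 → Fin 4 → A} {P : Fin 4 → A}

lemma pauliLub_time (h : IsPoincare x dx y dy s S P) (hw : IsWeyl dx y dy)
    (hs : s = 1 ∨ s = -1) :
    (1 / 2 : ℂ) • ∑ ν, ∑ ρ, ∑ σ, (levi 0 ν ρ σ * eta ν * eta ρ * eta σ) • (S ν ρ * P σ) =
      (-(s * Complex.I / 2)) • ((bil 1 x dx - bil 1 dy y + (2 : ℂ) • 1) * P 0) := by
  have h0 : S 2 3 = _ := h.rotation 0
  have h1 : S 3 1 = _ := h.rotation 1
  have h2 : S 1 2 = _ := h.rotation 2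
  have p0 : P 1 = _ := h.momentum_space 0
  have p1 : P 2 = _ := h.momentum_space 1
  have p2 : P 3 = _ := h.momentum_space 2
  have hf := hw.fierz_time (x := x) hs
  rw [Fin.sum_univ_three] at hf
  rw [levi_contract_time h.antisymm, h.momentum_time, mul_smul_comm, ← hf, h0, h1, h2, p0, p1, p2]
  simp only [smul_mul_smul_comm]
  module

lemma pauliLub_space (h : IsPoincare x dx y dy s S P) (hw : IsWeyl dx y dy)
    (hs : s = 1 ∨ s = -1) (i : Fin 3) :
    (1 / 2 : ℂ) • ∑ ν, ∑ ρ, ∑ σ, (levi i.succ ν ρ σ * eta ν * eta ρ * eta σ) • (S ν ρ * P σ) =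
      (-(s * Complex.I / 2)) • ((bil 1 x dx - bil 1 dy y + (2 : ℂ) • 1) * P i.succ) := by
  have hc := (hw.bil_commute (pauliSign s (i + 1)) (pauliSign s (i + 2))).eq
  have hs2 : s * s = 1 := by rcases hs with rfl | rfl <;> ring
  rw [levi_contract_space h.antisymm, h.momentum_space i, mul_smul_comm,
    ← hw.fierz_space (x := x) hs i, h.rotation, h.boost, h.boost, h.momentum_time,
    h.momentum_space, h.momentum_space]
  generalize bil (pauliSign s (i + 1)) x dx + bil (pauliSign s (i + 1)) dy y = K₁
  generalize bil (pauliSign s (i + 2)) x dx + bil (pauliSign s (i + 2)) dy y = K₂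
  generalize bil (pauliSign s i) x dx - bil (pauliSign s i) dy y = J
  simp only [add_mul, smul_mul_assoc, mul_smul_comm, hc]
  match_scalars
  all_goals
    first
    | ring1
    | linear_combination (-Complex.I ^ 3 / 4) * hs2 - (Complex.I / 4) * Complex.I_sq
    | linear_combination (Complex.I ^ 3 / 4) * hs2 + (Complex.I / 4) * Complex.I_sq

lemma massSq (h : IsPoincare x dx y dy s S P) (hw : IsWeyl dx y dy) (hs : s = 1 ∨ s = -1) :
    ∑ μ, eta μ • (P μ * P μ) = 0 := by
  have hf := hw.fierz_null hs
  rw [Fin.sum_univ_three] at hf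
  rw [Fin.sum_univ_succ, Fin.sum_univ_three, h.momentum_time, h.momentum_space, h.momentum_space,
    h.momentum_space]
  simp only [smul_mul_smul_comm, hf, eta]
  simp
  module

end IsPoincare

/-! ### The generators in blocks -/

lemma gam_zero : gam 0 = Matrix.fromBlocks 1 0 0 (-1) := by
  simp [gam, eta, gammaUp]

lemma gam_succ (i : Fin 3) : gam i.succ = Matrix.fromBlocks 0 (-pauli i) (pauli i) 0 := by
  have h : eta i.succ = -1 := by fin_cases i <;> rfl
  simp [gam, gammaUp, h, Matrix.fromBlocks_neg]

lemma pauli_mul_pauli_mul_pauli : pauli 0 * pauli 1 * pauli 2 = Complex.I • 1 := by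
  ext i j
  fin_cases i <;> fin_cases j <;> simp [pauli, Matrix.mul_apply]

lemma gam5_eq : gam5 = Matrix.fromBlocks 0 (-1) (-1) 0 := by
  have h0 : gammaUp 0 = Matrix.fromBlocks 1 0 0 (-1) := rfl
  have h1 : gammaUp 1 = Matrix.fromBlocks 0 (pauli 0) (-pauli 0) 0 := rfl
  have h2 : gammaUp 2 = Matrix.fromBlocks 0 (pauli 1) (-pauli 1) 0 := rfl
  have h3 : gammaUp 3 = Matrix.fromBlocks 0 (pauli 2) (-pauli 2) 0 := rfl
  rw [gam5, h0, h1, h2, h3]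
  simp [Matrix.fromBlocks_multiply, pauli_mul_pauli_mul_pauli, Matrix.fromBlocks_smul, smul_smul,
    Matrix.fromBlocks_neg]

lemma genP_zero : genP 0 = (-(Complex.I / 2)) • Matrix.fromBlocks 1 (-1) 1 (-1) := by
  rw [genP, genS5, genS4, gam5_eq, gam_zero]
  simp [Matrix.fromBlocks_multiply, Matrix.fromBlocks_smul, Matrix.fromBlocks_add,
    Matrix.fromBlocks_neg]

lemma genP_succ (i : Fin 3) : genP i.succ =
    (-(Complex.I / 2)) • Matrix.fromBlocks (pauli i) (-pauli i) (pauli i) (-pauli i) := by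
  rw [genP, genS5, genS4, gam5_eq, gam_succ]
  simp [Matrix.fromBlocks_multiply, Matrix.fromBlocks_smul, Matrix.fromBlocks_add,
    Matrix.fromBlocks_neg]

lemma genS_zero_succ (i : Fin 3) : genS 0 i.succ =
    (1 / 2 : ℂ) • Matrix.fromBlocks 0 (pauli i) (pauli i) 0 := by
  rw [genS, gam_zero, gam_succ]
  simp [Matrix.fromBlocks_multiply, Matrix.fromBlocks_smul, sub_eq_add_neg, Matrix.fromBlocks_add,
    Matrix.fromBlocks_neg]
  module

lemma pauli_commutator (i : Fin 3) : pauli (i + 1) * pauli (i + 2) - pauli (i + 2) * pauli (i + 1) =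
    (2 * Complex.I) • pauli i := by
  fin_cases i <;> ext j k <;> fin_cases j <;> fin_cases k <;>
    simp [pauli, Matrix.mul_apply] <;> ring_nf <;> simp

lemma genS_rotation (i : Fin 3) : genS (i + 1).succ (i + 2).succ =
    (Complex.I / 2) • Matrix.fromBlocks (pauli i) 0 0 (pauli i) := by
  have h := pauli_commutator i
  have h1 : gam (i + 1).succ * gam (i + 2).succ - gam (i + 2).succ * gam (i + 1).succ =
      (-(2 * Complex.I)) • Matrix.fromBlocks (pauli i) 0 0 (pauli i) := by
    rw [gam_succ, gam_succ]
    simp only [Matrix.fromBlocks_multiply, Matrix.fromBlocks_smul, sub_eq_add_neg,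
      Matrix.fromBlocks_add, Matrix.fromBlocks_neg]
    rw [neg_smul, ← h]
    congr 1 <;> simp <;> abel
  rw [genS, h1, smul_smul]
  congr 1
  ring

lemma genS_antisymm (μ ν : Fin 4) : genS μ ν = -genS ν μ := by
  rw [genS, genS, ← smul_neg, neg_sub]

lemma fundRep_fromBlocks (A B C D : Matrix (Fin 2) (Fin 2) ℂ) :
    fundRep (Matrix.fromBlocks A B C D) =
      bil A (oscAdag ∘ Sum.inl) (oscA ∘ Sum.inl) + bil B (oscAdag ∘ Sum.inl) (oscA ∘ Sum.inr) -
        (bil C (oscAdag ∘ Sum.inr) (oscA ∘ Sum.inl) +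
          bil D (oscAdag ∘ Sum.inr) (oscA ∘ Sum.inr)) := by
  simp only [fundRep, bil, Gam, Matrix.fromBlocks_multiply, Fintype.sum_sum_type,
    Matrix.fromBlocks_apply₁₁, Matrix.fromBlocks_apply₁₂, Matrix.fromBlocks_apply₂₁,
    Matrix.fromBlocks_apply₂₂, one_mul, zero_mul, add_zero, zero_add, neg_mul, Matrix.neg_apply,
    Finset.sum_add_distrib, Function.comp_apply]
  simp only [Fin.sum_univ_two]
  module

lemma isWeyl_of_osc {A : Type*} [Ring A] [Algebra ℂ A] {u v : Fin 2 ⊕ Fin 2 → A}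
    (hv : ∀ i j, v i * v j = v j * v i) (hu : ∀ i j, u i * u j = u j * u i)
    (hvu : ∀ i j, v i * u j = u j * v i + Gam i j • 1) (s : ℂ) :
    IsWeyl (v ∘ Sum.inl + s • v ∘ Sum.inr) (v ∘ Sum.inr) (u ∘ Sum.inr + s • u ∘ Sum.inl) where
  dx_dx α β := by
    simp only [Pi.add_apply, Pi.smul_apply, Function.comp_apply, add_mul, mul_add,
      smul_mul_smul_comm, smul_mul_assoc, mul_smul_comm]
    rw [hv (Sum.inl α), hv (Sum.inl α), hv (Sum.inr α), hv (Sum.inr α)]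
    module
  dy_dy α β := by
    simp only [Pi.add_apply, Pi.smul_apply, Function.comp_apply, add_mul, mul_add,
      smul_mul_smul_comm, smul_mul_assoc, mul_smul_comm]
    rw [hu (Sum.inl α), hu (Sum.inl α), hu (Sum.inr α), hu (Sum.inr α)]
    module
  dx_dy α β := by
    simp only [Pi.add_apply, Pi.smul_apply, Function.comp_apply, add_mul, mul_add,
      smul_mul_smul_comm, smul_mul_assoc, mul_smul_comm, hvu]
    simp only [Gam, Matrix.fromBlocks_apply₁₁, Matrix.fromBlocks_apply₁₂,
      Matrix.fromBlocks_apply₂₁, Matrix.fromBlocks_apply₂₂, Matrix.zero_apply, Matrix.neg_apply]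
    module
  dy_y α β := by
    have h1 : u (Sum.inr α) * v (Sum.inr β) = v (Sum.inr β) * u (Sum.inr α) +
        (if α = β then 1 else 0 : ℂ) • 1 := by
      rw [hvu]
      simp only [Gam, Matrix.fromBlocks_apply₂₂, Matrix.neg_apply, Matrix.one_apply,
        eq_comm (a := β)]
      module
    have h2 : u (Sum.inl α) * v (Sum.inr β) = v (Sum.inr β) * u (Sum.inl α) := by
      rw [hvu]
      simp [Gam]
    simp only [Pi.add_apply, Pi.smul_apply, Function.comp_apply, add_mul, mul_add,
      smul_mul_assoc, mul_smul_comm, h1, h2]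
    module

lemma isWeyl_osc (s : ℂ) : IsWeyl (oscA ∘ Sum.inl + s • oscA ∘ Sum.inr) (oscA ∘ Sum.inr)
    (oscAdag ∘ Sum.inr + s • oscAdag ∘ Sum.inl) :=
  isWeyl_of_osc oscA_mul_comm oscAdag_mul_comm oscA_mul_oscAdag s

lemma bil_neg {A : Type*} [Ring A] [Algebra ℂ A] (τ : Matrix (Fin 2) (Fin 2) ℂ)
    (u v : Fin 2 → A) : bil (-τ) u v = -bil τ u v := by
  rw [← neg_one_smul ℂ τ, bil_smul, neg_one_smul]

lemma bil_zero {A : Type*} [Ring A] [Algebra ℂ A] (u v : Fin 2 → A) : bil 0 u v = 0 := by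
  simp [bil]

lemma isPoincare_fundRep : IsPoincare
    (oscAdag ∘ Sum.inl) (oscA ∘ Sum.inl + (-1 : ℂ) • oscA ∘ Sum.inr)
    (oscA ∘ Sum.inr) (oscAdag ∘ Sum.inr + (-1 : ℂ) • oscAdag ∘ Sum.inl) 1
    (fun μ ν => fundRep (genS μ ν)) (fun μ => fundRep (genP μ)) where
  antisymm μ ν := by
    rw [genS_antisymm, fundRep_neg]
  momentum_time := by
    rw [genP_zero, fundRep_smul, fundRep_fromBlocks]
    simp only [bil_add_left, bil_add_right, bil_smul_left, bil_smul_right, bil_neg]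
    module
  momentum_space i := by
    rw [genP_succ, fundRep_smul, fundRep_fromBlocks, pauliSign_one]
    simp only [bil_add_left, bil_add_right, bil_smul_left, bil_smul_right, bil_neg]
    module
  boost i := by
    rw [genS_zero_succ, fundRep_smul, fundRep_fromBlocks, pauliSign_one]
    simp only [bil_add_left, bil_add_right, bil_smul_left, bil_smul_right, bil_neg, bil_zero]
    module
  rotation i := by
    rw [genS_rotation, fundRep_smul, fundRep_fromBlocks, pauliSign_one]
    simp only [bil_add_left, bil_add_right, bil_smul_left, bil_smul_right, bil_neg, bil_zero]
    module

lemma isPoincare_dualRep : IsPoincare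
    (oscAdag ∘ Sum.inl) (oscA ∘ Sum.inl + (1 : ℂ) • oscA ∘ Sum.inr)
    (oscA ∘ Sum.inr) (oscAdag ∘ Sum.inr + (1 : ℂ) • oscAdag ∘ Sum.inl) (-1)
    (fun μ ν => dualRep (genS μ ν)) (fun μ => dualRep (genP μ)) where
  antisymm μ ν := by
    rw [genS_antisymm, dualRep, dualRep, Matrix.transpose_neg, fundRep_neg]
  momentum_time := by
    rw [dualRep, genP_zero, Matrix.transpose_smul, Matrix.fromBlocks_transpose, fundRep_neg,
      fundRep_smul, fundRep_fromBlocks]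
    simp only [bil_add_left, bil_add_right, bil_smul_left, bil_smul_right, bil_neg,
      Matrix.transpose_neg, Matrix.transpose_one]
    module
  momentum_space i := by
    rw [dualRep, genP_succ, Matrix.transpose_smul, Matrix.fromBlocks_transpose, fundRep_neg,
      fundRep_smul, fundRep_fromBlocks, pauliSign_neg_one]
    simp only [bil_add_left, bil_add_right, bil_smul_left, bil_smul_right, bil_neg,
      Matrix.transpose_neg]
    module
  boost i := by
    rw [dualRep, genS_zero_succ, Matrix.transpose_smul, Matrix.fromBlocks_transpose, fundRep_neg,
      fundRep_smul, fundRep_fromBlocks, pauliSign_neg_one]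
    simp only [bil_add_left, bil_add_right, bil_smul_left, bil_smul_right, bil_neg, bil_zero,
      Matrix.transpose_zero]
    module
  rotation i := by
    rw [dualRep, genS_rotation, Matrix.transpose_smul, Matrix.fromBlocks_transpose, fundRep_neg,
      fundRep_smul, fundRep_fromBlocks, pauliSign_neg_one]
    simp only [bil_add_left, bil_add_right, bil_smul_left, bil_smul_right, bil_neg, bil_zero,
      Matrix.transpose_zero]
    module

/-- The representation `R` is given by bilinears of Poincaré type with respect to the sign `s`. -/
def IsPoincareRep (R : Mat → Module.End ℂ Fuzzy) (s : ℂ) : Prop :=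
  IsPoincare (oscAdag ∘ Sum.inl) (oscA ∘ Sum.inl + (-s) • oscA ∘ Sum.inr)
    (oscA ∘ Sum.inr) (oscAdag ∘ Sum.inr + (-s) • oscAdag ∘ Sum.inl) s
    (fun μ ν => R (genS μ ν)) (fun μ => R (genP μ))

lemma isPoincareRep_fundRep : IsPoincareRep fundRep 1 := isPoincare_fundRep

lemma isPoincareRep_dualRep : IsPoincareRep dualRep (-1) := by
  have h := isPoincare_dualRep
  rw [IsPoincareRep, neg_neg]
  exact h

lemma fundRep_one (s : ℂ) :
    bil 1 (oscAdag ∘ Sum.inl) (oscA ∘ Sum.inl + (-s) • oscA ∘ Sum.inr) -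
      bil 1 (oscAdag ∘ Sum.inr + (-s) • oscAdag ∘ Sum.inl) (oscA ∘ Sum.inr) = fundRep 1 := by
  rw [← Matrix.fromBlocks_one, fundRep_fromBlocks]
  simp only [bil_add_left, bil_add_right, bil_smul_left, bil_smul_right, bil_zero]
  module

lemma IsPoincareRep.massSq_eq_zero {R : Mat → Module.End ℂ Fuzzy} {s : ℂ} (h : IsPoincareRep R s)
    (hs : s = 1 ∨ s = -1) : massSq R = 0 :=
  h.massSq (isWeyl_osc (-s)) hs

lemma IsPoincareRep.pauliLub_eq {R : Mat → Module.End ℂ Fuzzy} {s : ℂ} (h : IsPoincareRep R s)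
    (hs : s = 1 ∨ s = -1) (μ : Fin 4) :
    pauliLub R μ = (-(s * Complex.I / 2)) • ((fundRep 1 + (2 : ℂ) • 1) * R (genP μ)) := by
  rw [← fundRep_one s]
  refine Fin.cases ?_ (fun i => ?_) μ
  · exact h.pauliLub_time (isWeyl_osc (-s)) hs
  · exact h.pauliLub_space (isWeyl_osc (-s)) hs i

lemma IsPoincareRep.pauliLub_apply {R : Mat → Module.End ℂ Fuzzy} {s : ℂ}
    (h : IsPoincareRep R s) (hs : s = 1 ∨ s = -1) {κ : ℂ}
    (hR : ∀ X, ∀ Ψ ∈ grade κ, R X Ψ ∈ grade κ) (μ : Fin 4) {Ψ : Fuzzy} (hΨ : Ψ ∈ grade κ) :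
    pauliLub R μ Ψ = (-(s * κ / 2)) • Complex.I • R (genP μ) Ψ := by
  rw [h.pauliLub_eq hs, LinearMap.smul_apply, Module.End.mul_apply, LinearMap.add_apply,
    fundRep_one_apply (hR _ Ψ hΨ), LinearMap.smul_apply, Module.End.one_apply]
  module

lemma IsPoincareRep.pauliLubSq_apply {R : Mat → Module.End ℂ Fuzzy} {s : ℂ}
    (h : IsPoincareRep R s) (hs : s = 1 ∨ s = -1) {κ : ℂ}
    (hR : ∀ X, ∀ Ψ ∈ grade κ, R X Ψ ∈ grade κ) {Ψ : Fuzzy} (hΨ : Ψ ∈ grade κ) :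
    pauliLubSq R Ψ = 0 := by
  have h1 : pauliLubSq R Ψ =
      ((-(s * κ / 2)) * Complex.I * ((-(s * κ / 2)) * Complex.I)) • massSq R Ψ := by
    rw [pauliLubSq, massSq, LinearMap.sum_apply, LinearMap.sum_apply, Finset.smul_sum]
    refine Finset.sum_congr rfl fun μ _ => ?_
    have hW : pauliLub R μ Ψ ∈ grade κ := by
      rw [h.pauliLub_apply hs hR μ hΨ]
      exact Submodule.smul_mem _ _ (Submodule.smul_mem _ _ (hR _ _ hΨ))
    rw [LinearMap.smul_apply, Module.End.mul_apply, h.pauliLub_apply hs hR μ hW,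
      h.pauliLub_apply hs hR μ hΨ, LinearMap.smul_apply, Module.End.mul_apply, map_smul, map_smul]
    module
  rw [h1, h.massSq_eq_zero hs, LinearMap.zero_apply, smul_zero]

/-! ### The Hilbert–Schmidt product -/

/-- The span of all rank one operators `(a†)ᵖ|0⟩⟨0|a^q`. -/
def rankOneSpan : Submodule ℂ Fuzzy := Submodule.span ℂ {Ψ | ∃ p q, Ψ = rankOne p q}

lemma rankOne_mem (p q : Occ) : rankOne p q ∈ rankOneSpan := Submodule.subset_span ⟨p, q, rfl⟩

lemma ladderSpan_rankOne_le (κ : ℤ) : ladderSpan rankOne κ ≤ rankOneSpan :=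
  Submodule.span_mono fun _ ⟨p, q, _, h⟩ => ⟨p, q, h⟩

lemma matElem_add (Ψ Φ : Fuzzy) (m n : Occ) :
    matElem (Ψ + Φ) m n = matElem Ψ m n + matElem Φ m n := by
  simp [matElem]

lemma matElem_smul (c : ℂ) (Ψ : Fuzzy) (m n : Occ) :
    matElem (c • Ψ) m n = c * matElem Ψ m n := by
  simp [matElem]

lemma mbra_apply_mket (Φ : Fuzzy) (p q : Occ) : mbra p (Φ (mket q)) =
    ((√(occFact p : ℝ) : ℝ) : ℂ) * ((√(occFact q : ℝ) : ℝ) : ℂ) * matElem Φ p q := by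
  rw [mbra, mket, map_smul, LinearMap.smul_apply, map_smul, Module.Basis.coord_apply, matElem]
  simp only [smul_eq_mul]
  ring

lemma matElem_rankOne (p q m n : Occ) : matElem (rankOne p q) m n =
    if m = p ∧ n = q then ((√(occFact p : ℝ) : ℝ) : ℂ) * ((√(occFact q : ℝ) : ℝ) : ℂ) else 0 := by
  rw [matElem, rankOne_apply, map_smul, mbra, mket, map_smul, LinearMap.smul_apply,
    Module.Basis.coord_apply, ket, ket, Module.Basis.repr_self, Module.Basis.repr_self]
  simp only [Finsupp.smul_apply, Finsupp.single_apply, smul_eq_mul]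
  by_cases h1 : m = p
  · by_cases h2 : n = q
    · subst h1 h2
      simp [mul_comm]
    · simp [h1, h2]
  · simp [h1, Ne.symm h1]

lemma finite_support_matElem {Ψ : Fuzzy} (hΨ : Ψ ∈ rankOneSpan) :
    (Function.support fun r : Occ × Occ => matElem Ψ r.1 r.2).Finite := by
  induction hΨ using Submodule.span_induction with
  | mem Ψ h =>
    obtain ⟨p, q, rfl⟩ := h
    refine (Set.finite_singleton (p, q)).subset fun r hr => ?_
    rw [Function.mem_support, matElem_rankOne] at hr
    have := (ite_ne_right_iff.1 hr).1
    exact Prod.ext this.1 this.2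
  | zero => simp [matElem, Function.support]
  | add Ψ Φ _ _ h1 h2 =>
    simp only [matElem_add]
    exact (h1.union h2).subset (Function.support_add _ _)
  | smul c Ψ _ h =>
    simp only [matElem_smul]
    exact h.subset fun r hr => right_ne_zero_of_mul hr

lemma isHS_of_mem_rankOneSpan {Ψ : Fuzzy} (hΨ : Ψ ∈ rankOneSpan) : IsHS Ψ :=
  summable_of_hasFiniteSupport ((finite_support_matElem hΨ).subset fun r hr h => hr (by simp [h]))

lemma summable_hsInner {Ψ : Fuzzy} (hΨ : Ψ ∈ rankOneSpan) (Φ : Fuzzy) :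
    Summable fun r : Occ × Occ =>
      (starRingEnd ℂ) (matElem Ψ r.1 r.2) * matElem Φ r.1 r.2 :=
  summable_of_hasFiniteSupport ((finite_support_matElem hΨ).subset fun r hr h => hr (by simp [h]))

lemma hsInner_add_left {Ψ Ψ' : Fuzzy} (hΨ : Ψ ∈ rankOneSpan) (hΨ' : Ψ' ∈ rankOneSpan)
    (Φ : Fuzzy) : hsInner (Ψ + Ψ') Φ = hsInner Ψ Φ + hsInner Ψ' Φ := by
  rw [hsInner, hsInner, hsInner,
    ← (summable_hsInner hΨ Φ).tsum_add (summable_hsInner hΨ' Φ)]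
  simp only [matElem_add, map_add, add_mul]

lemma hsInner_smul_left (c : ℂ) (Ψ Φ : Fuzzy) :
    hsInner (c • Ψ) Φ = (starRingEnd ℂ) c * hsInner Ψ Φ := by
  rw [hsInner, hsInner, ← tsum_mul_left]
  simp only [matElem_smul, map_mul, mul_assoc]

lemma hsInner_add_right {Ψ : Fuzzy} (hΨ : Ψ ∈ rankOneSpan) (Φ Φ' : Fuzzy) :
    hsInner Ψ (Φ + Φ') = hsInner Ψ Φ + hsInner Ψ Φ' := by
  rw [hsInner, hsInner, hsInner,
    ← (summable_hsInner hΨ Φ).tsum_add (summable_hsInner hΨ Φ')]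
  simp only [matElem_add, mul_add]

lemma hsInner_smul_right (c : ℂ) (Ψ Φ : Fuzzy) : hsInner Ψ (c • Φ) = c * hsInner Ψ Φ := by
  rw [hsInner, hsInner, ← tsum_mul_left]
  refine tsum_congr fun r => ?_
  rw [matElem_smul]
  ring

lemma hsInner_zero_left (Φ : Fuzzy) : hsInner 0 Φ = 0 := by
  simp [hsInner, matElem]

lemma hsInner_zero_right (Ψ : Fuzzy) : hsInner Ψ 0 = 0 := by
  simp [hsInner, matElem]

lemma hsInner_sum_left {ι : Type*} (S : Finset ι) {Ψ : ι → Fuzzy}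
    (hΨ : ∀ i, Ψ i ∈ rankOneSpan) (Φ : Fuzzy) :
    hsInner (∑ i ∈ S, Ψ i) Φ = ∑ i ∈ S, hsInner (Ψ i) Φ := by
  classical
  induction S using Finset.induction_on with
  | empty => simp [hsInner_zero_left]
  | insert i S hi ih =>
    rw [Finset.sum_insert hi, Finset.sum_insert hi,
      hsInner_add_left (hΨ i) (Submodule.sum_mem _ fun j _ => hΨ j), ih]

lemma hsInner_sum_right {ι : Type*} (S : Finset ι) {Ψ : Fuzzy} (hΨ : Ψ ∈ rankOneSpan)
    (Φ : ι → Fuzzy) : hsInner Ψ (∑ i ∈ S, Φ i) = ∑ i ∈ S, hsInner Ψ (Φ i) := by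
  classical
  induction S using Finset.induction_on with
  | empty => simp [hsInner_zero_right]
  | insert i S hi ih =>
    rw [Finset.sum_insert hi, Finset.sum_insert hi, hsInner_add_right hΨ, ih]

lemma hsInner_rankOne (p q : Occ) (Φ : Fuzzy) :
    hsInner (rankOne p q) Φ = mbra p (Φ (mket q)) := by
  rw [hsInner, tsum_eq_single (p, q), mbra_apply_mket, matElem_rankOne, if_pos ⟨rfl, rfl⟩]
  · simp
  · intro r hr
    rw [matElem_rankOne, if_neg]
    · simp
    · rintro ⟨h1, h2⟩
      exact hr (Prod.ext h1 h2)

lemma map_rankOneSpan {T : Module.End ℂ Fuzzy} (h : ∀ p q, T (rankOne p q) ∈ rankOneSpan)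
    {Ψ : Fuzzy} (hΨ : Ψ ∈ rankOneSpan) : T Ψ ∈ rankOneSpan := by
  have : rankOneSpan ≤ rankOneSpan.comap T := by
    rw [rankOneSpan, Submodule.span_le]
    rintro _ ⟨p, q, rfl⟩
    exact h p q
  exact this hΨ

lemma oscA_mem_rankOneSpan (i : Fin 2 ⊕ Fin 2) {Ψ : Fuzzy} (hΨ : Ψ ∈ rankOneSpan) :
    oscA i Ψ ∈ rankOneSpan := by
  refine map_rankOneSpan (fun p q => ?_) hΨ
  rcases i with α | α
  · exact (isLadder_rankOne.dx_apply α p q).symm ▸ Submodule.smul_mem _ _ (rankOne_mem _ _)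
  · exact (isLadder_rankOne.y_apply α p q).symm ▸ rankOne_mem _ _

lemma oscAdag_mem_rankOneSpan (i : Fin 2 ⊕ Fin 2) {Ψ : Fuzzy} (hΨ : Ψ ∈ rankOneSpan) :
    oscAdag i Ψ ∈ rankOneSpan := by
  refine map_rankOneSpan (fun p q => ?_) hΨ
  rcases i with α | α
  · exact (isLadder_rankOne.x_apply α p q).symm ▸ rankOne_mem _ _
  · exact (isLadder_rankOne.dy_apply α p q).symm ▸ Submodule.smul_mem _ _ (rankOne_mem _ _)

lemma hsInner_adjoint {T T' : Module.End ℂ Fuzzy}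
    (hT : ∀ Ψ ∈ rankOneSpan, T Ψ ∈ rankOneSpan)
    (h : ∀ p q Φ, hsInner (T (rankOne p q)) Φ = hsInner (rankOne p q) (T' Φ)) {Ψ : Fuzzy}
    (hΨ : Ψ ∈ rankOneSpan) (Φ : Fuzzy) : hsInner (T Ψ) Φ = hsInner Ψ (T' Φ) := by
  induction hΨ using Submodule.span_induction with
  | mem Ψ hm =>
    obtain ⟨p, q, rfl⟩ := hm
    exact h p q Φ
  | zero => rw [map_zero, hsInner_zero_left, hsInner_zero_left]
  | add Ψ Ψ' h1 h2 e1 e2 =>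
    rw [map_add, hsInner_add_left (hT _ h1) (hT _ h2), hsInner_add_left h1 h2, e1, e2]
  | smul c Ψ _ e => rw [map_smul, hsInner_smul_left, hsInner_smul_left, e]

lemma hsInner_oscA (i : Fin 2 ⊕ Fin 2) {Ψ : Fuzzy} (hΨ : Ψ ∈ rankOneSpan) (Φ : Fuzzy) :
    hsInner (oscA i Ψ) Φ = hsInner Ψ (oscAdag i Φ) := by
  refine hsInner_adjoint (fun _ h => oscA_mem_rankOneSpan i h) (fun p q Φ => ?_) hΨ Φ
  rcases i with α | α
  · have h1 : oscA (Sum.inl α) (rankOne p q) = _ := isLadder_rankOne.dx_apply α p q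
    have h2 := LinearMap.congr_fun (mbra_comp_cre α p) (Φ (mket q))
    rw [h1, hsInner_smul_left, hsInner_rankOne, hsInner_rankOne]
    simpa [oscAdag] using h2.symm
  · have h1 : oscA (Sum.inr α) (rankOne p q) = _ := isLadder_rankOne.y_apply α p q
    rw [h1, hsInner_rankOne, hsInner_rankOne]
    simp [oscAdag, cre_mket]

lemma hsInner_oscAdag (i : Fin 2 ⊕ Fin 2) {Ψ : Fuzzy} (hΨ : Ψ ∈ rankOneSpan) (Φ : Fuzzy) :
    hsInner (oscAdag i Ψ) Φ = hsInner Ψ (oscA i Φ) := by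
  refine hsInner_adjoint (fun _ h => oscAdag_mem_rankOneSpan i h) (fun p q Φ => ?_) hΨ Φ
  rcases i with α | α
  · have h1 : oscAdag (Sum.inl α) (rankOne p q) = _ := isLadder_rankOne.x_apply α p q
    have h2 := LinearMap.congr_fun (mbra_comp_ann α p) (Φ (mket q))
    rw [h1, hsInner_rankOne, hsInner_rankOne]
    simpa [oscA] using h2.symm
  · have h1 : oscAdag (Sum.inr α) (rankOne p q) = _ := isLadder_rankOne.dy_apply α p q
    rw [h1, hsInner_smul_left, hsInner_rankOne, hsInner_rankOne]
    simp [oscA, ann_mket]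

lemma hsInner_fundRep {X : Mat} (hX : X ∈ su22) {Ψ : Fuzzy} (hΨ : Ψ ∈ rankOneSpan) (Φ : Fuzzy) :
    hsInner (fundRep X Ψ) Φ = -hsInner Ψ (fundRep X Φ) := by
  have hc : ∀ i j, (starRingEnd ℂ) ((Gam * X) i j) = -(Gam * X) j i := by
    intro i j
    have h1 : X.conjTranspose * Gam = -(Gam * X) := eq_neg_of_add_eq_zero_left hX.1
    have h2 : (Gam * X).conjTranspose = -(Gam * X) := by
      rw [Matrix.conjTranspose_mul, Gam_conjTranspose, h1]
    exact congrFun (congrFun h2 j) i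
  have hm : ∀ i j, (oscAdag i * oscA j) Ψ ∈ rankOneSpan := fun i j =>
    oscAdag_mem_rankOneSpan i (oscA_mem_rankOneSpan j hΨ)
  have e1 : hsInner (fundRep X Ψ) Φ =
      ∑ i, ∑ j, hsInner ((Gam * X) i j • (oscAdag i * oscA j) Ψ) Φ := by
    simp only [fundRep, LinearMap.sum_apply, LinearMap.smul_apply]
    exact (hsInner_sum_left _
      (fun i => Submodule.sum_mem _ fun j _ => Submodule.smul_mem _ _ (hm i j)) Φ).trans
      (Finset.sum_congr rfl fun i _ =>
        hsInner_sum_left _ (fun j => Submodule.smul_mem _ _ (hm i j)) Φ)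
  have e2 : hsInner Ψ (fundRep X Φ) =
      ∑ i, ∑ j, hsInner Ψ ((Gam * X) i j • (oscAdag i * oscA j) Φ) := by
    simp only [fundRep, LinearMap.sum_apply, LinearMap.smul_apply]
    exact (hsInner_sum_right _ hΨ _).trans
      (Finset.sum_congr rfl fun i _ => hsInner_sum_right _ hΨ _)
  rw [e1, e2, Finset.sum_comm, ← Finset.sum_neg_distrib]
  refine Finset.sum_congr rfl fun j _ => ?_
  rw [← Finset.sum_neg_distrib]
  refine Finset.sum_congr rfl fun i _ => ?_
  rw [hsInner_smul_left, hsInner_smul_right, hc, Module.End.mul_apply, Module.End.mul_apply,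
    hsInner_oscAdag i (oscA_mem_rankOneSpan j hΨ), hsInner_oscA j hΨ]
  ring

/-! ### The conformal energy -/

lemma energy_fundRep_apply (Ψ : Fuzzy) : energy fundRep Ψ =
    (1 / 2 : ℂ) • (numOp * Ψ + Ψ * numOp + (2 : ℂ) • Ψ) := by
  have h : genS5 0 = (-(Complex.I / 2)) • Matrix.fromBlocks ((1 : ℂ) • 1) 0 0 ((-1 : ℂ) • 1) := by
    rw [genS5, gam_zero]
    simp
  have hI : Complex.I * -(Complex.I / 2) = 1 / 2 := by
    linear_combination (-1 / 2 : ℂ) * Complex.I_mul_I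
  rw [energy, h, fundRep_smul, LinearMap.smul_apply, LinearMap.smul_apply,
    fundRep_fromBlocks_smul_one, smul_smul, hI]
  module

lemma energy_apply_of_mem_grade {κ : ℂ} {Ψ : Fuzzy} (hΨ : Ψ ∈ grade κ) :
    energy fundRep Ψ = Ψ * numOp + (1 + κ / 2) • Ψ := by
  rw [energy_fundRep_apply, mem_grade.1 hΨ]
  module

lemma energy_eq_smul_iff {κ E : ℂ} {Ψ : Fuzzy} (hΨ : Ψ ∈ grade κ) :
    energy fundRep Ψ = E • Ψ ↔ Ψ * numOp = (E - (1 + κ / 2)) • Ψ := by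
  rw [energy_apply_of_mem_grade hΨ, sub_smul, eq_sub_iff_add_eq]

lemma exists_nat_of_mul_numOp {Ψ : Fuzzy} (h0 : Ψ ≠ 0) {c : ℂ} (h : Ψ * numOp = c • Ψ) :
    ∃ k : ℕ, c = k := by
  by_contra! hc
  refine h0 (fock_hom_ext fun n => ?_)
  have h1 := LinearMap.congr_fun h (mket n)
  rw [Module.End.mul_apply, numOp_mket, map_smul, LinearMap.smul_apply, ← sub_eq_zero,
    ← sub_smul, smul_eq_zero, sub_eq_zero] at h1
  exact h1.resolve_left (Ne.symm (hc _))

lemma sector_eq_grade_natCast (κ : ℕ) : sector κ = grade κ := by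
  rw [sector_eq_grade, Int.cast_natCast]

lemma ladderSpan_rankOne_le_grade (κ : ℤ) : ladderSpan rankOne κ ≤ grade κ := by
  rw [ladderSpan, Submodule.span_le]
  rintro _ ⟨p, q, h, rfl⟩
  rw [← h]
  exact rankOne_mem_grade p q

lemma energy_rankOne {κ : ℕ} {p q : Occ} (h : chirality p q = κ) :
    energy fundRep (rankOne p q) = ((1 + (κ : ℝ) / 2 + tot q : ℝ) : ℂ) • rankOne p q := by
  have hg := rankOne_mem_grade p q
  rw [h, Int.cast_natCast] at hg
  rw [energy_apply_of_mem_grade hg, rankOne_mul_numOp]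
  push_cast
  module

lemma spectrum_sector (κ : ℕ) : eigenvaluesOn (energy fundRep) (sector κ) =
    Set.range fun k : ℕ => ((1 + (κ : ℝ) / 2 + k : ℝ) : ℂ) := by
  ext E
  constructor
  · rintro ⟨Ψ, hΨ, h0, hE⟩
    rw [sector_eq_grade_natCast] at hΨ
    obtain ⟨k, hk⟩ := exists_nat_of_mul_numOp h0 ((energy_eq_smul_iff hΨ).1 hE)
    refine ⟨k, ?_⟩
    push_cast
    linear_combination -hk
  · rintro ⟨k, rfl⟩
    have hc : chirality (Pi.single 0 (κ + k)) (Pi.single 0 k) = κ := by simp [chirality]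
    refine ⟨rankOne (Pi.single 0 (κ + k)) (Pi.single 0 k), ?_, rankOne_ne_zero _ _, ?_⟩
    · rw [sector_eq_grade, ← hc]
      exact rankOne_mem_grade _ _
    · rw [energy_rankOne hc]
      simp [tot]

lemma finiteVectors_sector (κ : ℕ) :
    finiteVectors (energy fundRep) (sector κ) = ladderSpan rankOne κ := by
  refine le_antisymm ?_ ?_
  · rw [finiteVectors, Submodule.span_le]
    rintro Ψ ⟨hΨ, E, hE⟩
    rw [sector_eq_grade_natCast] at hΨ
    by_cases h0 : Ψ = 0
    · rw [h0]
      exact Submodule.zero_mem _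
    · have h1 := (energy_eq_smul_iff hΨ).1 hE
      obtain ⟨k, hk⟩ := exists_nat_of_mul_numOp h0 h1
      rw [hk] at h1
      refine Submodule.span_mono ?_ (mem_span_rankOne hΨ h1)
      rintro _ ⟨p, q, hq, hp, rfl⟩
      refine ⟨p, q, ?_, rfl⟩
      have hp' : tot p = k + κ := by exact_mod_cast hp
      rw [chirality_eq]
      omega
  · rw [ladderSpan, Submodule.span_le]
    rintro _ ⟨p, q, h, rfl⟩
    refine Submodule.subset_span ⟨?_, _, energy_rankOne h⟩
    rw [sector_eq_grade, ← h]
    exact rankOne_mem_grade p q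

lemma finiteVectors_ladderSpan (κ : ℕ) :
    finiteVectors (energy fundRep) (ladderSpan rankOne κ) = ladderSpan rankOne κ := by
  refine le_antisymm ?_ ?_
  · rw [finiteVectors, Submodule.span_le]
    exact fun Ψ hΨ => hΨ.1
  · conv_lhs => rw [ladderSpan]
    rw [Submodule.span_le]
    rintro _ ⟨p, q, h, rfl⟩
    exact Submodule.subset_span ⟨IsLadder.mem_ladderSpan h, _, energy_rankOne h⟩

lemma eigenvaluesOn_mono {H : Module.End ℂ Fuzzy} {V V' : Submodule ℂ Fuzzy} (h : V ≤ V') :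
    eigenvaluesOn H V ⊆ eigenvaluesOn H V' :=
  fun _ ⟨Ψ, hΨ, h'⟩ => ⟨Ψ, h hΨ, h'⟩

lemma ladderSpan_rankOne_le_sector (κ : ℕ) : ladderSpan rankOne κ ≤ sector κ := by
  rw [sector_eq_grade]
  exact ladderSpan_rankOne_le_grade κ

lemma exists_of_mem_eigenvaluesOn {κ : ℕ} {E : ℂ}
    (hE : E ∈ eigenvaluesOn (energy fundRep) (ladderSpan rankOne κ)) :
    ∃ k : ℕ, ((1 + (κ : ℝ) / 2 + k : ℝ) : ℂ) = E := by
  have h := eigenvaluesOn_mono (ladderSpan_rankOne_le_sector κ) hE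
  rwa [spectrum_sector] at h

lemma isLeast_energy (κ : ℕ) :
    IsLeast (Complex.re '' eigenvaluesOn (energy fundRep) (ladderSpan rankOne κ))
      (1 + (κ : ℝ) / 2) := by
  constructor
  · have hc : chirality (Pi.single 0 κ) 0 = κ := by simp [chirality]
    refine ⟨((1 + (κ : ℝ) / 2 : ℝ) : ℂ), ⟨rankOne (Pi.single 0 κ) 0, IsLadder.mem_ladderSpan hc,
      rankOne_ne_zero _ _, ?_⟩, Complex.ofReal_re _⟩
    rw [energy_rankOne hc]
    simp
  · rintro _ ⟨E, hE, rfl⟩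
    obtain ⟨k, rfl⟩ := exists_of_mem_eigenvaluesOn hE
    rw [Complex.ofReal_re]
    have : (0 : ℝ) ≤ k := Nat.cast_nonneg k
    linarith

/-! ### Irreducibility -/

lemma fundRep_mem_ladderSpan_rankOne {κ : ℤ} {Ψ : Fuzzy} (hΨ : Ψ ∈ ladderSpan rankOne κ)
    (X : Mat) : fundRep X Ψ ∈ ladderSpan rankOne κ := by
  refine fundRep_mem (fun i j => ?_) X
  have h1 : oscA j Ψ ∈ ladderSpan rankOne (κ - 1) := by
    rcases j with α | α
    · exact isLadder_rankOne.dx_mem hΨ α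
    · exact isLadder_rankOne.y_mem hΨ α
  have h2 : oscAdag i (oscA j Ψ) ∈ ladderSpan rankOne (κ - 1 + 1) := by
    rcases i with α | α
    · exact isLadder_rankOne.x_mem h1 α
    · exact isLadder_rankOne.dy_mem h1 α
  rwa [sub_add_cancel] at h2

lemma fundRep_mem_monoSpan {κ : ℤ} {Ψ : Fuzzy} (hΨ : Ψ ∈ monoSpan κ) (X : Mat) :
    fundRep X Ψ ∈ monoSpan κ := by
  refine fundRep_mem (fun i j => ?_) X
  have h1 : oscA j Ψ ∈ ladderSpan monomial (κ - 1) := by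
    rcases j with α | α
    · have h := Submodule.add_mem _ (isLadder_monomial.dx_mem hΨ α) (isLadder_monomial.y_mem hΨ α)
      rwa [LinearMap.sub_apply, sub_add_cancel] at h
    · exact isLadder_monomial.y_mem hΨ α
  have h2 : oscAdag i (oscA j Ψ) ∈ ladderSpan monomial (κ - 1 + 1) := by
    rcases i with α | α
    · exact isLadder_monomial.x_mem h1 α
    · have h := Submodule.add_mem _ (isLadder_monomial.dy_mem h1 α) (isLadder_monomial.x_mem h1 α)
      rwa [adCre, LinearMap.sub_apply,
        sub_add_cancel (LinearMap.mulRight ℂ (cre α) (oscA j Ψ))] at h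
  rw [sub_add_cancel] at h2
  exact h2

lemma isIrred_rankOne (κ : ℕ) : IsIrred fundRep su22 (ladderSpan rankOne κ) := by
  refine ⟨fun X _ Ψ hΨ => fundRep_mem_ladderSpan_rankOne hΨ X, ?_, fun U hU hinv => ?_⟩
  · intro h
    have hc : chirality (Pi.single 0 κ) 0 = κ := by simp [chirality]
    have h1 : rankOne (Pi.single 0 κ) 0 ∈ ladderSpan rankOne κ := IsLadder.mem_ladderSpan hc
    rw [h, Submodule.mem_bot] at h1
    exact rankOne_ne_zero _ _ h1
  · have key := fun i j Ψ (hΨ : Ψ ∈ U) => bilinear_mem_of_isInvariant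
      (hU.trans (ladderSpan_rankOne_le_grade κ)) hinv i j hΨ
    exact isLadder_rankOne.eq_bot_or_eq_ladderSpan hU
      (fun α β => key (Sum.inl α) (Sum.inl β)) (fun α β => key (Sum.inl α) (Sum.inr β))
      (fun α β => key (Sum.inr α) (Sum.inl β)) (fun α β => key (Sum.inr α) (Sum.inr β))

lemma monoSpan_le_grade (κ : ℤ) : monoSpan κ ≤ grade κ := by
  rw [monoSpan, Submodule.span_le]
  rintro _ ⟨n, m, h, rfl⟩
  rw [← h]
  exact monomial_mem_grade n m

lemma isIrred_monoSpan (κ : ℕ) : IsIrred fundRep su22 (monoSpan κ) := by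
  refine ⟨fun X _ Ψ hΨ => fundRep_mem_monoSpan hΨ X, ?_, fun U hU hinv => ?_⟩
  · intro h
    have hc : chirality (Pi.single 0 κ) 0 = κ := by simp [chirality]
    have h1 : monomial (Pi.single 0 κ) 0 ∈ monoSpan κ := Submodule.subset_span ⟨_, _, hc, rfl⟩
    rw [h, Submodule.mem_bot] at h1
    exact monomial_ne_zero _ _ h1
  · have key := fun i j Ψ (hΨ : Ψ ∈ U) => bilinear_mem_of_isInvariant
      (hU.trans (monoSpan_le_grade κ)) hinv i j hΨ
    have hdx : ∀ i β, ∀ Ψ ∈ U, oscAdag i ((LinearMap.mulLeft ℂ (ann β) -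
        LinearMap.mulRight ℂ (ann β)) Ψ) ∈ U := by
      intro i β Ψ hΨ
      rw [LinearMap.sub_apply, map_sub]
      exact U.sub_mem (key i (Sum.inl β) Ψ hΨ) (key i (Sum.inr β) Ψ hΨ)
    exact isLadder_monomial.eq_bot_or_eq_ladderSpan hU
      (fun α β => hdx (Sum.inl α) β) (fun α β => key (Sum.inl α) (Sum.inr β))
      (fun α β Ψ hΨ => U.sub_mem (hdx (Sum.inr α) β Ψ hΨ) (hdx (Sum.inl α) β Ψ hΨ))
      (fun α β Ψ hΨ => U.sub_mem (key (Sum.inr α) (Sum.inr β) Ψ hΨ)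
        (key (Sum.inl α) (Sum.inr β) Ψ hΨ))

/-! ### The lowest energy space -/

/-- The span of the rank one operators `(a†)ᵖ|0⟩⟨0|` with `p₁ + p₂ = κ`. -/
def lowestSpan (κ : ℕ) : Submodule ℂ Fuzzy :=
  Submodule.span ℂ {Ψ | ∃ p, tot p = κ ∧ Ψ = rankOne p 0}

lemma chirality_zero_right {κ : ℕ} {p : Occ} (hp : tot p = κ) : chirality p 0 = κ := by
  rw [chirality_eq, hp]
  simp

lemma numOp_mul_of_mem_lowestSpan {κ : ℕ} {Ψ : Fuzzy} (hΨ : Ψ ∈ lowestSpan κ) :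
    numOp * Ψ = (κ : ℂ) • Ψ := by
  induction hΨ using Submodule.span_induction with
  | mem Ψ h =>
    obtain ⟨p, hp, rfl⟩ := h
    have hg := rankOne_mem_grade p 0
    rw [chirality_zero_right hp, Int.cast_natCast] at hg
    rw [mem_grade.1 hg, rankOne_mul_numOp]
    simp
  | zero => simp
  | add Ψ Φ _ _ h1 h2 => rw [mul_add, h1, h2, smul_add]
  | smul c Ψ _ h => rw [mul_smul_comm, h, smul_comm]

lemma eigenspaceIn_lowest (κ : ℕ) :
    eigenspaceIn (energy fundRep) (ladderSpan rankOne κ) ((1 + (κ : ℝ) / 2 : ℝ) : ℂ) =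
      lowestSpan κ := by
  refine le_antisymm ?_ ?_
  · rintro Ψ ⟨hΨ, hE⟩
    have hg := ladderSpan_rankOne_le_grade κ hΨ
    rw [Int.cast_natCast] at hg
    have hE' : energy fundRep Ψ = ((1 + (κ : ℝ) / 2 : ℝ) : ℂ) • Ψ := by
      rw [SetLike.mem_coe, LinearMap.mem_ker, LinearMap.sub_apply, sub_eq_zero] at hE
      exact hE
    have h1 := (energy_eq_smul_iff hg).1 hE'
    have h2 : Ψ * numOp = ((0 : ℕ) : ℂ) • Ψ := by
      rw [h1]
      push_cast
      rw [sub_self]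
    refine Submodule.span_mono ?_ (mem_span_rankOne hg h2)
    rintro _ ⟨p, q, hq, hp, rfl⟩
    refine ⟨p, ?_, by rw [tot_eq_zero hq]⟩
    rw [Nat.cast_zero, zero_add] at hp
    exact_mod_cast hp
  · rw [lowestSpan, Submodule.span_le]
    rintro _ ⟨p, hp, rfl⟩
    refine ⟨IsLadder.mem_ladderSpan (chirality_zero_right hp), ?_⟩
    rw [SetLike.mem_coe, LinearMap.mem_ker, LinearMap.sub_apply,
      energy_rankOne (chirality_zero_right hp)]
    simp

lemma oscAdag_inr_oscA_inr_of_mem_lowestSpan {κ : ℕ} {Ψ : Fuzzy} (hΨ : Ψ ∈ lowestSpan κ)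
    (α β : Fin 2) : (oscAdag (Sum.inr α) * oscA (Sum.inr β)) Ψ =
      (if α = β then 1 else 0 : ℂ) • Ψ := by
  induction hΨ using Submodule.span_induction with
  | mem Ψ h =>
    obtain ⟨p, -, rfl⟩ := h
    have h1 : oscA (Sum.inr β) (rankOne p 0) = _ := isLadder_rankOne.y_apply β p 0
    have h2 : oscAdag (Sum.inr α) (rankOne p (0 + Pi.single β 1)) = _ :=
      isLadder_rankOne.dy_apply α p _
    rw [Module.End.mul_apply, h1, h2]
    by_cases h : α = β
    · subst h
      rw [add_single_sub_single]
      simp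
    · simp [h]
  | zero => simp
  | add Ψ Φ _ _ h1 h2 => rw [map_add, h1, h2, smul_add]
  | smul c Ψ _ h => rw [map_smul, h, smul_comm]

lemma fundRep_blockDiag_of_mem_lowestSpan {κ : ℕ} {Ψ : Fuzzy} (hΨ : Ψ ∈ lowestSpan κ)
    (A : Matrix (Fin 2) (Fin 2) ℂ) {B : Matrix (Fin 2) (Fin 2) ℂ} (hB : B.trace = 0) :
    fundRep (Matrix.fromBlocks A 0 0 B) Ψ =
      ∑ α, ∑ β, A α β • (oscAdag (Sum.inl α) * oscA (Sum.inl β)) Ψ := by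
  rw [fundRep_fromBlocks_diag]
  simp only [oscAdag_inr_oscA_inr_of_mem_lowestSpan hΨ]
  rw [Matrix.trace, Fin.sum_univ_two] at hB
  simp only [Matrix.diag_apply] at hB
  have h : ∑ α, ∑ β, B α β • (if α = β then 1 else 0 : ℂ) • Ψ = 0 := by
    simp only [Fin.sum_univ_two]
    simp only [← add_smul, Fin.isValue, if_true, one_smul, zero_ne_one, one_ne_zero, if_false,
      zero_smul, smul_zero, add_zero, zero_add]
    rw [hB, zero_smul]
  rw [h, sub_zero]

lemma bilinear_mem_lowestSpan {κ : ℕ} {Ψ : Fuzzy} (hΨ : Ψ ∈ lowestSpan κ) (α β : Fin 2) :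
    (oscAdag (Sum.inl α) * oscA (Sum.inl β)) Ψ ∈ lowestSpan κ := by
  induction hΨ using Submodule.span_induction with
  | mem Ψ h =>
    obtain ⟨p, hp, rfl⟩ := h
    have h1 : oscA (Sum.inl β) (rankOne p 0) = _ := isLadder_rankOne.dx_apply β p 0
    have h2 : oscAdag (Sum.inl α) (rankOne (p - Pi.single β 1) 0) = _ :=
      isLadder_rankOne.x_apply α _ 0
    rw [Module.End.mul_apply, h1, map_smul, h2]
    by_cases h : p β = 0
    · simp [h]
    · obtain ⟨m, rfl⟩ := exists_add_single h
      rw [add_single_sub_single]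
      refine Submodule.smul_mem _ _ (Submodule.subset_span ⟨_, ?_, rfl⟩)
      rw [tot_add_single] at hp ⊢
      exact hp
  | zero => simp
  | add Ψ Φ _ _ h1 h2 => rw [map_add]; exact Submodule.add_mem _ h1 h2
  | smul c Ψ _ h => rw [map_smul]; exact Submodule.smul_mem _ _ h

/-- A traceless `2 × 2` matrix is a complex combination of two elements of `su(2)`. -/
lemma exists_su2_add_smul {A : Matrix (Fin 2) (Fin 2) ℂ} (hA : A.trace = 0) :
    ∃ Y Z : Matrix (Fin 2) (Fin 2) ℂ, Y.conjTranspose = -Y ∧ Y.trace = 0 ∧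
      Z.conjTranspose = -Z ∧ Z.trace = 0 ∧ A = Y + Complex.I • Z := by
  refine ⟨(1 / 2 : ℂ) • (A - A.conjTranspose), (-Complex.I / 2) • (A + A.conjTranspose),
    ?_, ?_, ?_, ?_, ?_⟩
  · rw [Matrix.conjTranspose_smul, Matrix.conjTranspose_sub, Matrix.conjTranspose_conjTranspose]
    simp
    module
  · rw [Matrix.trace_smul, Matrix.trace_sub, Matrix.trace_conjTranspose, hA]; simp
  · rw [Matrix.conjTranspose_smul, Matrix.conjTranspose_add, Matrix.conjTranspose_conjTranspose]
    simp
    module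
  · rw [Matrix.trace_smul, Matrix.trace_add, Matrix.trace_conjTranspose, hA]; simp
  · rw [smul_smul]
    have : Complex.I * (-Complex.I / 2) = 1 / 2 := by
      linear_combination (-1 / 2 : ℂ) * Complex.I_mul_I
    rw [this]
    module

lemma fundRep_block_mem_of_isInvariant {κ : ℕ} {U : Submodule ℂ Fuzzy} (hU : U ≤ lowestSpan κ)
    (hinv : IsInvariant fundRep su2su2 U) {Ψ : Fuzzy} (hΨ : Ψ ∈ U)
    (A : Matrix (Fin 2) (Fin 2) ℂ) : fundRep (Matrix.fromBlocks A 0 0 0) Ψ ∈ U := by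
  have htr : (A - (A.trace / 2) • (1 : Matrix (Fin 2) (Fin 2) ℂ)).trace = 0 := by
    rw [Matrix.trace_sub, Matrix.trace_smul, Matrix.trace_one]
    simp
  obtain ⟨Y, Z, hY, tY, hZ, tZ, h⟩ := exists_su2_add_smul htr
  have hsplit : Matrix.fromBlocks A 0 0 0 = Matrix.fromBlocks Y 0 0 0 +
      Complex.I • Matrix.fromBlocks Z 0 0 0 +
      Matrix.fromBlocks ((A.trace / 2) • (1 : Matrix (Fin 2) (Fin 2) ℂ)) 0 0
        ((0 : ℂ) • (1 : Matrix (Fin 2) (Fin 2) ℂ)) := by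
    rw [Matrix.fromBlocks_smul, Matrix.fromBlocks_add, Matrix.fromBlocks_add, ← h]
    simp
  have hmem : ∀ Y : Matrix (Fin 2) (Fin 2) ℂ, Y.conjTranspose = -Y → Y.trace = 0 →
      fundRep (Matrix.fromBlocks Y 0 0 0) Ψ ∈ U := fun Y hY tY =>
    hinv _ ⟨Y, 0, hY, tY, by simp, by simp, rfl⟩ Ψ hΨ
  rw [hsplit, fundRep_add, fundRep_add, fundRep_smul, LinearMap.add_apply, LinearMap.add_apply,
    LinearMap.smul_apply, fundRep_fromBlocks_smul_one, numOp_mul_of_mem_lowestSpan (hU hΨ),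
    zero_smul, sub_zero]
  exact U.add_mem (U.add_mem (hmem Y hY tY) (U.smul_mem _ (hmem Z hZ tZ)))
    (U.smul_mem _ (U.smul_mem _ hΨ))

lemma isIrred_lowestSpan (κ : ℕ) : IsIrred fundRep su2su2 (lowestSpan κ) := by
  refine ⟨?_, ?_, fun U hU hinv => ?_⟩
  · rintro _ ⟨A, B, -, -, -, tB, rfl⟩ Ψ hΨ
    rw [fundRep_blockDiag_of_mem_lowestSpan hΨ A tB]
    exact Submodule.sum_mem _ fun α _ => Submodule.sum_mem _ fun β _ =>
      Submodule.smul_mem _ _ (bilinear_mem_lowestSpan hΨ α β)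
  · intro h
    have h1 : rankOne (Pi.single 0 κ) 0 ∈ lowestSpan κ :=
      Submodule.subset_span ⟨_, by simp [tot], rfl⟩
    rw [h, Submodule.mem_bot] at h1
    exact rankOne_ne_zero _ _ h1
  · refine isLadder_rankOne.eq_bot_or_eq_span_lowest hU fun α β Ψ hΨ => ?_
    have h := fundRep_block_mem_of_isInvariant hU hinv hΨ (Matrix.single α β 1)
    rw [fundRep_blockDiag_of_mem_lowestSpan (hU hΨ) _ (Matrix.trace_zero _ _)] at h
    simpa [Matrix.single_apply, ite_and, ite_smul, oscA, oscAdag] using h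

/-- The Casimir operator of the oscillator realisation of `su(2)`. -/
lemma sum_bil_pauli_sq {A : Type*} [Ring A] [Algebra ℂ A] {u v : Fin 2 → A}
    (hu : u 1 * u 0 = u 0 * u 1) (h : IsWeyl 0 u v) :
    ∑ k, bil (pauli k) u v * bil (pauli k) u v =
      bil 1 u v * bil 1 u v + (2 : ℂ) • bil 1 u v := by
  simp only [bil, pauli, Fin.sum_univ_two, Fin.sum_univ_three]
  simp [add_mul, mul_add, sub_mul, mul_sub, mul_assoc, smul_smul, smul_add, smul_sub,
    h.normalOrder, hu, assoc_of_mul_eq hu]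
  module

lemma casimirLeft_fundRep : casimirLeft fundRep =
    (1 / 4 : ℂ) • (fundRep (Matrix.fromBlocks 1 0 0 0) * fundRep (Matrix.fromBlocks 1 0 0 0) +
      (2 : ℂ) • fundRep (Matrix.fromBlocks 1 0 0 0)) := by
  have hw : IsWeyl (0 : Fin 2 → Module.End ℂ Fuzzy) (oscAdag ∘ Sum.inl) (oscA ∘ Sum.inl) :=
    { dx_dx := by simp
      dx_dy := by simp
      dy_dy := fun α β => oscA_mul_comm _ _
      dy_y := fun α β => by
        have h := oscA_mul_oscAdag (Sum.inl α) (Sum.inl β)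
        simpa only [Gam, Matrix.fromBlocks_apply₁₁, Matrix.one_apply, Function.comp_apply] using h }
  have hblock : ∀ A : Matrix (Fin 2) (Fin 2) ℂ, fundRep (Matrix.fromBlocks A 0 0 0) =
      bil A (oscAdag ∘ Sum.inl) (oscA ∘ Sum.inl) := by
    intro A
    rw [fundRep_fromBlocks]
    simp only [bil_zero, add_zero, sub_zero]
  have hsum := sum_bil_pauli_sq (oscAdag_mul_comm (Sum.inl 1) (Sum.inl 0)) hw
  rw [casimirLeft]
  simp only [hblock, bil_smul, smul_mul_smul_comm]
  rw [← Finset.smul_sum, hsum]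
  congr 1
  norm_num

lemma hasSpins_fundRep (κ : ℕ) : HasSpins fundRep (lowestSpan κ) ((κ : ℝ) / 2) 0 := by
  refine ⟨isIrred_lowestSpan κ, fun Ψ hΨ => ?_, fun Ψ hΨ => ?_⟩
  · have hN : ∀ Φ : Fuzzy, fundRep (Matrix.fromBlocks 1 0 0 0) Φ = numOp * Φ := by
      intro Φ
      have h := fundRep_fromBlocks_smul_one 1 0 Φ
      rwa [one_smul, zero_smul, one_smul, zero_smul, sub_zero] at h
    rw [casimirLeft_fundRep, LinearMap.smul_apply, LinearMap.add_apply, Module.End.mul_apply,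
      LinearMap.smul_apply, hN, hN, numOp_mul_of_mem_lowestSpan hΨ, mul_smul_comm,
      numOp_mul_of_mem_lowestSpan hΨ]
    push_cast
    module
  · have hz : ∀ k, fundRep (Matrix.fromBlocks 0 0 0 ((1 / 2 : ℂ) • pauli k)) Ψ = 0 := by
      intro k
      rw [fundRep_blockDiag_of_mem_lowestSpan hΨ]
      · simp
      · rw [Matrix.trace_smul, Matrix.trace, Fin.sum_univ_two]
        fin_cases k <;> simp [pauli]
    rw [casimirRight, LinearMap.sum_apply]
    simp only [Module.End.mul_apply, hz, map_zero, Finset.sum_const_zero]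
    simp

attribute [local instance 100] LieRing.ofAssociativeRing

/-! ### The dual representation -/

lemma neg_transpose_mem_su22 {X : Mat} (hX : X ∈ su22) : -X.transpose ∈ su22 := by
  obtain ⟨h, ht⟩ := hX
  refine ⟨?_, by rw [Matrix.trace_neg, Matrix.trace_transpose, ht, neg_zero]⟩
  have h1 : Gam * (X.conjTranspose * Gam + Gam * X) * Gam = 0 := by rw [h, mul_zero, zero_mul]
  have h2 : Gam * X.conjTranspose + X * Gam = 0 := by
    rw [mul_add, add_mul, ← mul_assoc, ← mul_assoc, Gam_mul_Gam, one_mul, mul_assoc _ Gam Gam,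
      Gam_mul_Gam, mul_one] at h1
    exact h1
  have h3 := congrArg Matrix.transpose h2
  rw [Matrix.transpose_add, Matrix.transpose_mul, Matrix.transpose_mul, Gam_transpose,
    Matrix.transpose_zero] at h3
  have h4 : (-X.transpose).conjTranspose = -X.conjTranspose.transpose := by
    rw [Matrix.conjTranspose_neg]
    rfl
  rw [h4, neg_mul, mul_neg, ← neg_add, h3, neg_zero]

lemma neg_transpose_mem_su2su2 {X : Mat} (hX : X ∈ su2su2) : -X.transpose ∈ su2su2 := by
  obtain ⟨A, B, hA, tA, hB, tB, rfl⟩ := hX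
  have key : ∀ A : Matrix (Fin 2) (Fin 2) ℂ, A.conjTranspose = -A →
      (-A.transpose).conjTranspose = -(-A.transpose) := by
    intro A hA
    have h : A.transpose.conjTranspose = A.conjTranspose.transpose := rfl
    rw [Matrix.conjTranspose_neg, h, hA, Matrix.transpose_neg]
  refine ⟨-A.transpose, -B.transpose, key A hA, ?_, key B hB, ?_, ?_⟩
  · rw [Matrix.trace_neg, Matrix.trace_transpose, tA, neg_zero]
  · rw [Matrix.trace_neg, Matrix.trace_transpose, tB, neg_zero]
  · rw [Matrix.fromBlocks_transpose, Matrix.fromBlocks_neg]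
    simp

lemma isInvariant_dualRep_iff {𝔤 : Set Mat} (h𝔤 : ∀ X ∈ 𝔤, -X.transpose ∈ 𝔤)
    (V : Submodule ℂ Fuzzy) : IsInvariant dualRep 𝔤 V ↔ IsInvariant fundRep 𝔤 V := by
  refine ⟨fun h X hX Ψ hΨ => ?_, fun h X hX Ψ hΨ => h _ (h𝔤 X hX) Ψ hΨ⟩
  have h1 := h _ (h𝔤 X hX) Ψ hΨ
  rwa [dualRep, Matrix.transpose_neg, Matrix.transpose_transpose, neg_neg] at h1

lemma IsIrred.dualRep {𝔤 : Set Mat} (h𝔤 : ∀ X ∈ 𝔤, -X.transpose ∈ 𝔤) {V : Submodule ℂ Fuzzy}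
    (h : IsIrred fundRep 𝔤 V) : IsIrred dualRep 𝔤 V :=
  ⟨(isInvariant_dualRep_iff h𝔤 V).2 h.1, h.2.1, fun U hU hinv =>
    h.2.2 U hU ((isInvariant_dualRep_iff h𝔤 U).1 hinv)⟩

lemma neg_energy_dualRep : -energy dualRep = energy fundRep := by
  have h : (genS5 0).transpose = genS5 0 := by
    rw [genS5, gam_zero, Matrix.transpose_smul, Matrix.fromBlocks_transpose]
    simp
  rw [energy, energy, dualRep, h, fundRep_neg, smul_neg, neg_neg]

lemma pauli_transpose (k : Fin 3) :
    (pauli k).transpose = pauli k ∨ (pauli k).transpose = -pauli k := by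
  fin_cases k
  · left
    ext i j
    fin_cases i <;> fin_cases j <;> simp [pauli]
  · right
    ext i j
    fin_cases i <;> fin_cases j <;> simp [pauli]
  · left
    ext i j
    fin_cases i <;> fin_cases j <;> simp [pauli]

lemma dualRep_mul_self {X : Mat} (hX : X.transpose = X ∨ X.transpose = -X) :
    dualRep X * dualRep X = fundRep X * fundRep X := by
  rcases hX with h | h
  · rw [dualRep, h, fundRep_neg]
    exact neg_mul_neg (fundRep X) (fundRep X)
  · rw [dualRep, h, neg_neg]

lemma casimirLeft_dualRep : casimirLeft dualRep = casimirLeft fundRep := by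
  refine Finset.sum_congr rfl fun k _ => dualRep_mul_self ?_
  rw [Matrix.fromBlocks_transpose, Matrix.transpose_smul, Matrix.fromBlocks_neg]
  rcases pauli_transpose k with h | h <;> simp [h]

lemma casimirRight_dualRep : casimirRight dualRep = casimirRight fundRep := by
  refine Finset.sum_congr rfl fun k _ => dualRep_mul_self ?_
  rw [Matrix.fromBlocks_transpose, Matrix.transpose_smul, Matrix.fromBlocks_neg]
  rcases pauli_transpose k with h | h <;> simp [h]

/-! ### The massless fields -/

lemma exists_lieHom_of_commutator {R : Mat → Module.End ℂ Fuzzy}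
    (hadd : ∀ X Y, R (X + Y) = R X + R Y) (hsmul : ∀ (c : ℂ) X, R (c • X) = c • R X)
    (hlie : ∀ X Y, R X * R Y - R Y * R X = R (X * Y - Y * X)) :
    ∃ φ : su22 →ₗ⁅ℝ⁆ Module.End ℂ Fuzzy, ∀ X : su22, φ X = R X :=
  ⟨{ toFun := fun X => R X
     map_add' := fun X Y => hadd X Y
     map_smul' := fun r X => hsmul (r : ℂ) X
     map_lie' := fun {X Y} => (hlie X Y).symm }, fun _ => rfl⟩

lemma dualRep_commutator (X Y : Mat) :
    dualRep X * dualRep Y - dualRep Y * dualRep X = dualRep (X * Y - Y * X) := by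
  rw [dualRep, dualRep, dualRep, fundRep_commutator]
  congr 1
  rw [Matrix.transpose_sub, Matrix.transpose_mul, Matrix.transpose_mul]
  noncomm_ring

lemma isUnitaryLowestWeight_fundRep (κ : ℕ) :
    IsUnitaryLowestWeight fundRep (energy fundRep) (ladderSpan rankOne κ)
      (1 + (κ : ℝ) / 2) ((κ : ℝ) / 2) 0 where
  irred := isIrred_rankOne κ
  hilbertSchmidt Ψ hΨ := isHS_of_mem_rankOneSpan (ladderSpan_rankOne_le κ hΨ)
  unitary X hX Ψ hΨ Φ _ := hsInner_fundRep hX (ladderSpan_rankOne_le κ hΨ) Φ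
  spanned := finiteVectors_ladderSpan κ
  real E hE := by
    obtain ⟨k, rfl⟩ := exists_of_mem_eigenvaluesOn hE
    exact Complex.ofReal_im _
  lowest := isLeast_energy κ
  lowestSpins := by
    rw [eigenspaceIn_lowest]
    exact hasSpins_fundRep κ

lemma isUnitaryLowestWeight_dualRep (κ : ℕ) :
    IsUnitaryLowestWeight dualRep (energy fundRep) (ladderSpan rankOne κ)
      (1 + (κ : ℝ) / 2) ((κ : ℝ) / 2) 0 where
  irred := (isIrred_rankOne κ).dualRep fun _ => neg_transpose_mem_su22
  hilbertSchmidt := (isUnitaryLowestWeight_fundRep κ).hilbertSchmidt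
  unitary X hX := (isUnitaryLowestWeight_fundRep κ).unitary _ (neg_transpose_mem_su22 hX)
  spanned := finiteVectors_ladderSpan κ
  real := (isUnitaryLowestWeight_fundRep κ).real
  lowest := isLeast_energy κ
  lowestSpins := by
    rw [eigenspaceIn_lowest]
    refine ⟨(isIrred_lowestSpan κ).dualRep fun _ => neg_transpose_mem_su2su2, ?_, ?_⟩
    · rw [casimirLeft_dualRep]
      exact (hasSpins_fundRep κ).2.1
    · rw [casimirRight_dualRep]
      exact (hasSpins_fundRep κ).2.2

lemma isMasslessField_of_isPoincareRep {R : Mat → Module.End ℂ Fuzzy} {κ : ℕ} {s : ℝ}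
    (hs : s = 1 ∨ s = -1) (hP : IsPoincareRep R s)
    (hR : ∀ X, ∀ Ψ ∈ grade κ, R X Ψ ∈ grade κ)
    (hφ : ∃ φ : su22 →ₗ⁅ℝ⁆ Module.End ℂ Fuzzy, ∀ X : su22, φ X = R X)
    (hirr : IsIrred R su22 (monoSpan κ))
    (hu : IsUnitaryLowestWeight R (energy fundRep) (ladderSpan rankOne κ)
      (1 + (κ : ℝ) / 2) ((κ : ℝ) / 2) 0) :
    IsMasslessField R κ (energy fundRep) (s * ((κ : ℝ) / 2)) := by
  have hs' : (s : ℂ) = 1 ∨ (s : ℂ) = -1 := by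
    rcases hs with rfl | rfl <;> simp
  refine ⟨hφ, ?_, hirr, ?_, ?_, ?_, ?_, spectrum_sector κ, ?_⟩
  · rw [sector_eq_grade]
    exact monoSpan_le_grade κ
  · rw [sector_eq_grade_natCast]
    exact fun X _ => hR X
  · intro Ψ _
    rw [hP.massSq_eq_zero hs', LinearMap.zero_apply]
  · rw [sector_eq_grade_natCast]
    exact fun Ψ => hP.pauliLubSq_apply hs' hR
  · intro μ Ψ hΨ
    rw [sector_eq_grade_natCast] at hΨ
    rw [hP.pauliLub_apply hs' hR μ hΨ]
    push_cast
    module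
  · rw [finiteVectors_sector]
    exact hu

lemma dualRep_add (X Y : Mat) : dualRep (X + Y) = dualRep X + dualRep Y := by
  rw [dualRep, dualRep, dualRep, Matrix.transpose_add, neg_add, fundRep_add]

lemma dualRep_smul (c : ℂ) (X : Mat) : dualRep (c • X) = c • dualRep X := by
  rw [dualRep, dualRep, Matrix.transpose_smul, ← smul_neg, fundRep_smul]

lemma isMasslessField_fundRep (κ : ℕ) :
    IsMasslessField fundRep κ (energy fundRep) ((κ : ℝ) / 2) := by
  have hP : IsPoincareRep fundRep ((1 : ℝ) : ℂ) := by
    rw [Complex.ofReal_one]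
    exact isPoincareRep_fundRep
  have h := isMasslessField_of_isPoincareRep (κ := κ) (Or.inl rfl) hP
    (fun X Ψ hΨ => fundRep_mem_grade hΨ X)
    (exists_lieHom_of_commutator fundRep_add fundRep_smul fundRep_commutator)
    (isIrred_monoSpan κ) (isUnitaryLowestWeight_fundRep κ)
  rwa [one_mul] at h

lemma isMasslessField_dualRep (κ : ℕ) :
    IsMasslessField dualRep κ (-energy dualRep) (-((κ : ℝ) / 2)) := by
  have hP : IsPoincareRep dualRep ((-1 : ℝ) : ℂ) := by
    rw [Complex.ofReal_neg, Complex.ofReal_one]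
    exact isPoincareRep_dualRep
  have h := isMasslessField_of_isPoincareRep (κ := κ) (Or.inr rfl) hP
    (fun X Ψ hΨ => fundRep_mem_grade hΨ (-X.transpose))
    (exists_lieHom_of_commutator dualRep_add dualRep_smul dualRep_commutator)
    ((isIrred_monoSpan κ).dualRep fun _ => neg_transpose_mem_su22)
    (isUnitaryLowestWeight_dualRep κ)
  rw [neg_energy_dualRep]
  rwa [neg_one_mul] at h

end FuzzyDoubleton

theorem theorem2 (κ : ℕ) :
    FuzzyDoubleton.IsMasslessField FuzzyDoubleton.fundRep κ
      (FuzzyDoubleton.energy FuzzyDoubleton.fundRep) ((κ : ℝ) / 2) ∧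
    FuzzyDoubleton.IsMasslessField FuzzyDoubleton.dualRep κ
      (-FuzzyDoubleton.energy FuzzyDoubleton.dualRep) (-((κ : ℝ) / 2)) :=
  ⟨FuzzyDoubleton.isMasslessField_fundRep κ, FuzzyDoubleton.isMasslessField_dualRep κ⟩
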